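/- Let $Q$ be a perfect group with a balanced presentation $\mathcal P$, that is, a finite presentation with the same number $k$ of generators and relators, and suppose that $H_3(Q)\neq 0$ (homology of groups is taken with coefficients in the trivial module $\mathbb Z$). Let $F$ be the free group on the $k$ generators of $\mathcal P$, let $p\colon F\twoheadrightarrow Q$ be the associated epimorphism, and let $F\times_Q F=\{(x,y)\in F\times F : p(x)=p(y)\}$. Then there exist free groups $\mathcal E$ and $\mathcal F$ on $2k$ letters, epimorphisms $\mathcal E\twoheadrightarrow F\times_Q F$ with kernel $K$ and $\mathcal F\twoheadrightarrow F\times F$ with kernel $L$, and a homomorphism $\mathcal E\to\mathcal F$ covering the inclusion $F\times_Q F\hookrightarrow F\times F$. For every such choice, let $$\Phi\colon \mathcal E/[\mathcal E,K]\to\mathcal F/[\mathcal F,L]$$ be the induced homomorphism. Then: 1. $\mathcal E/[\mathcal E,K]$ is finitely generated. 2. $\Phi$ is homologically $2$-connected, that is, it induces an isomorphism on $H_1$ and an epimorphism on $H_2$. 3. $\gamma_\omega(\mathcal E/[\mathcal E,K])\neq\{1\}$ and $\gamma_{\omega+1}(\mathcal E/[\mathcal E,K])=\{1\}$. 4. $\mathcal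 F/[\mathcal F,L]$ is residually nilpotent, that is, $\gamma_\omega(\mathcal F/[\mathcal F,L])=\{1\}$. 5. If $Q$ is finite, then $\mathcal E/[\mathcal E,K]$ is finitely presented. Here $\gamma_\alpha(G)$ is the transfinite lower central series of $G$: $\gamma_1(G)=G$, $\gamma_{\alpha+1}(G)=[G,\gamma_\alpha(G)]$, and $\gamma_\lambda(G)=\bigcap_{\alpha<\lambda}\gamma_\alpha(G)$ for limit ordinals $\lambda$. -/

import Mathlib

open scoped Ordinal

noncomputable section

namespace FreeCentral

/-! ### Integral group homology and homologically 2-connected homomorphisms -/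

/-- The integral homology group `H_n(G) = H_n(G; ℤ)`, with `G` acting trivially on `ℤ`. -/
abbrev integralHomology (G : Type) [Group G] (n : ℕ) : ModuleCat ℤ :=
  groupHomology (Rep.trivial ℤ G ℤ) n

/-- The identity of `ℤ`, as a morphism from the trivial `G`-module `ℤ` to the restriction along
`f : G →* Γ` of the trivial `Γ`-module `ℤ`. -/
def trivialHom {G Γ : Type} [Group G] [Group Γ] (f : G →* Γ) :
    Rep.trivial ℤ G ℤ ⟶ Rep.res f (Rep.trivial ℤ Γ ℤ) :=
  Rep.ofHom ⟨LinearMap.id, fun _ => rfl⟩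

/-- The homomorphism `H_n(G) ⟶ H_n(Γ)` induced by `f : G →* Γ` and the identity of `ℤ`. -/
abbrev integralHomologyMap {G Γ : Type} [Group G] [Group Γ] (f : G →* Γ) (n : ℕ) :
    integralHomology G n ⟶ integralHomology Γ n :=
  groupHomology.map f (trivialHom f) n

/-- `f` is homologically 2-connected if it is an isomorphism on `H₁` and onto on `H₂`. -/
def HomologicallyTwoConnected {G Γ : Type} [Group G] [Group Γ] (f : G →* Γ) : Prop :=
  Function.Bijective (integralHomologyMap f 1) ∧ Function.Surjective (integralHomologyMap f 2)

/-! ### The transfinite lower central series -/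

/-- The transfinite lower central series, indexed so that `γ₁(G) = G`,
`γ_{α+1}(G) = [G, γ_α(G)]` for `α ≥ 1`, and `γ_l(G) = ⋂_{α < l} γ_α(G)` for limit `l`.
The (unused) term of index `0` is also `G`. -/
def transfiniteLCS (G : Type) [Group G] (α : Ordinal.{0}) : Subgroup G :=
  Ordinal.limitRecOn α ⊤
    (fun β γβ => if β = 0 then ⊤ else ⁅(⊤ : Subgroup G), γβ⁆)
    (fun l _ γ => ⨅ (β : Ordinal.{0}) (h : β < l), γ β h)

theorem transfiniteLCS_one (G : Type) [Group G] : transfiniteLCS G 1 = ⊤ := by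
  have h : (1 : Ordinal.{0}) = 0 + 1 := (zero_add 1).symm
  rw [transfiniteLCS, h, Ordinal.limitRecOn_add_one, if_pos rfl]

theorem transfiniteLCS_add_one (G : Type) [Group G] {α : Ordinal.{0}} (hα : α ≠ 0) :
    transfiniteLCS G (α + 1) = ⁅(⊤ : Subgroup G), transfiniteLCS G α⁆ := by
  rw [transfiniteLCS, Ordinal.limitRecOn_add_one, if_neg hα, transfiniteLCS]

theorem transfiniteLCS_limit (G : Type) [Group G] {l : Ordinal.{0}} (hl : Order.IsSuccLimit l) :
    transfiniteLCS G l = ⨅ (β : Ordinal.{0}) (_ : β < l), transfiniteLCS G β := by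
  rw [transfiniteLCS, Ordinal.limitRecOn_limit _ _ _ _ hl]
  rfl

/-- A group is residually nilpotent if `γ_ω(G) = 1`. -/
def ResiduallyNilpotent (G : Type) [Group G] : Prop :=
  transfiniteLCS G ω = ⊥

/-! ### Balanced presentations, fiber products and free central extensions -/

/-- A presentation of `Q` with finitely many generators and the same number of relators
(the relators form a family, so repetitions are allowed). -/
structure BalancedPresentation (Q : Type) [Group Q] where
  /-- the common number of generators and relators -/
  rank : ℕ
  /-- the generators -/
  gen : Fin rank → Q
  /-- the relators -/
  rel : Fin rank → FreeGroup (Fin rank)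
  surjective_lift : Function.Surjective (FreeGroup.lift gen)
  ker_lift : (FreeGroup.lift gen).ker = Subgroup.normalClosure (Set.range rel)

namespace BalancedPresentation

variable {Q : Type} [Group Q] (P : BalancedPresentation Q)

/-- The free group `F` on the generators of the presentation. -/
abbrev F : Type := FreeGroup (Fin P.rank)

/-- The projection `p : F → Q`. -/
abbrev p : P.F →* Q := FreeGroup.lift P.gen

/-- The fiber product `F ×_Q F = {(x, y) | p x = p y}`, as a subgroup of `F × F`. -/
abbrev fiberProduct : Subgroup (P.F × P.F) :=
  (P.p.comp (MonoidHom.fst P.F P.F)).eqLocus (P.p.comp (MonoidHom.snd P.F P.F))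

end BalancedPresentation

/-- For `K` normal in `E`, the group `E / [E, K]`. -/
abbrev CentralQuotient {E : Type} [Group E] (K : Subgroup E) [K.Normal] : Type :=
  E ⧸ ⁅(⊤ : Subgroup E), K⁆

/-- Free groups `𝓔`, `𝓕` on `2k` letters (`k` the number of generators of the balanced
presentation) with `𝓔 / K ≅ F ×_Q F` and `𝓕 / L ≅ F × F`, given as epimorphisms with kernels
`K` and `L`, together with a homomorphism `𝓔 → 𝓕` covering the inclusion
`F ×_Q F → F × F`. -/
structure FreeCover {Q : Type} [Group Q] (P : BalancedPresentation Q) where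
  /-- the epimorphism `𝓔 → F ×_Q F` -/
  projE : FreeGroup (Fin (2 * P.rank)) →* P.fiberProduct
  projE_surjective : Function.Surjective projE
  /-- the epimorphism `𝓕 → F × F` -/
  projF : FreeGroup (Fin (2 * P.rank)) →* P.F × P.F
  projF_surjective : Function.Surjective projF
  /-- the homomorphism `𝓔 → 𝓕` -/
  cover : FreeGroup (Fin (2 * P.rank)) →* FreeGroup (Fin (2 * P.rank))
  projF_comp_cover : projF.comp cover = P.fiberProduct.subtype.comp projE

namespace FreeCover

variable {Q : Type} [Group Q] {P : BalancedPresentation Q} (D : FreeCover P)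

/-- The kernel `K` of `𝓔 → F ×_Q F`. -/
abbrev K : Subgroup (FreeGroup (Fin (2 * P.rank))) := D.projE.ker

/-- The kernel `L` of `𝓕 → F × F`. -/
abbrev L : Subgroup (FreeGroup (Fin (2 * P.rank))) := D.projF.ker

theorem commutator_le_comap :
    ⁅(⊤ : Subgroup (FreeGroup (Fin (2 * P.rank)))), D.K⁆ ≤
      Subgroup.comap D.cover ⁅(⊤ : Subgroup (FreeGroup (Fin (2 * P.rank)))), D.L⁆ := by
  rw [← Subgroup.map_le_iff_le_comap, Subgroup.map_commutator]
  refine Subgroup.commutator_mono le_top ?_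
  rw [Subgroup.map_le_iff_le_comap]
  intro x hx
  have h := DFunLike.congr_fun D.projF_comp_cover x
  have hx' : D.projE x = 1 := hx
  simp only [MonoidHom.comp_apply, hx', map_one] at h
  exact h

/-- The homomorphism `Φ : 𝓔 / [𝓔, K] → 𝓕 / [𝓕, L]` induced by `𝓔 → 𝓕`. -/
def Phi : CentralQuotient D.K →* CentralQuotient D.L :=
  QuotientGroup.map _ _ D.cover D.commutator_le_comap

end FreeCover

end FreeCentral

end

noncomputable section

open scoped commutatorElement

namespace FreeCentral

/-! ### The lower central series up to `ω` -/

/-! Write R for the kernel of F → Q. Since Q is perfect, F = R[F, F], so R × R, which lies in F ×_Q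
F, already maps onto F_ab × F_ab. Balancedness makes F ×_Q F a quotient of a free group 𝓔 on 2k
letters (diagonal generators, and relators in the first factor). An epimorphism from such a free
group to F_ab × F_ab ≅ ℤ^{2k} has kernel the commutator subgroup
(`ker_eq_commutator_of_surjective`). Hence 𝓔 → 𝓕 is an isomorphism on abelianizations, and K and L
consist of products of commutators. In homological terms K/[𝓔, K] is H₂(F ×_Q F) and L/[𝓕, L] is
H₂(F × F).

The key computation is `L_le_map_cross_sup`: modulo [𝓕, L], the group L is generated by images of
commutators of lifts to 𝓔 of (r, 1) and (1, s), with r and s in R. So K/[𝓔, K] → L/[𝓕, L] is onto.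
Consequently a central extension of 𝓕/[𝓕, L] to which Φ lifts splits (`exists_splitting_of_lift`);
by duality with ℚ/ℤ this is surjectivity on H₂.

This map of central subgroups is not injective when H₃(Q) ≠ 0 (`exists_mem_of_nontrivial`). Pull a
3-cocycle c on Q back to F, where it is the coboundary of some b. The difference of the two
pullbacks of b to F ×_Q F is a 2-cocycle. If the map were injective, the corresponding central
extension would split, b could be corrected to descend to Q, and c would be a coboundary.

An element k of 𝓔 outside [𝓔, K] but mapping into [𝓕, L] gives a nontrivial element of γ_ω: the
subgroup [𝓕, L] lies in the image of [𝓔, K] modulo every term of the lower central series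
(`commutator_le_map_commutator_sup`), and 𝓔 → 𝓕 reflects that series
(`mem_lowerCentralSeries_of_map_mem`). On the other hand F × F is residually nilpotent, so γ_ω lies
in the central subgroups K/[𝓔, K] and L/[𝓕, L] respectively. The first inclusion gives γ_{ω+1} = 1.
For the second, a Heisenberg group detects L/[𝓕, L] in nilpotency class two, so γ_ω = 1.

For finite Q, F ×_Q F is a split extension of F by the finitely generated free group R, hence
finitely presented. -/

theorem transfiniteLCS_natCast_add_one (G : Type) [Group G] (n : ℕ) :
    transfiniteLCS G ((n : Ordinal.{0}) + 1) = (⊤ : Subgroup G).lowerCentralSeries n := by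
  induction n with
  | zero => simpa using transfiniteLCS_one G
  | succ n ih =>
    rw [transfiniteLCS_add_one G (by exact_mod_cast n.succ_ne_zero), Nat.cast_succ, ih,
      Subgroup.commutator_comm, Subgroup.lowerCentralSeries_succ]

theorem transfiniteLCS_omega0 (G : Type) [Group G] :
    transfiniteLCS G ω = ⨅ n : ℕ, (⊤ : Subgroup G).lowerCentralSeries n := by
  rw [transfiniteLCS_limit G Ordinal.isSuccLimit_omega0]
  refine le_antisymm (le_iInf fun n => ?_) (le_iInf₂ fun β hβ => ?_)
  · rw [← transfiniteLCS_natCast_add_one]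
    exact iInf₂_le _ (by exact_mod_cast Ordinal.natCast_lt_omega0 (n + 1))
  · obtain ⟨m, rfl⟩ := Ordinal.lt_omega0.1 hβ
    cases m with
    -- The conventional term of index `0` is the whole group, so it does not affect the
    -- intersection.
    | zero => simp [transfiniteLCS]
    | succ m =>
      rw [Nat.cast_succ, transfiniteLCS_natCast_add_one]
      exact iInf_le _ m

theorem map_mem_lowerCentralSeries {G H : Type*} [Group G] [Group H] (f : G →* H) {n : ℕ} {x : G}
    (hx : x ∈ (⊤ : Subgroup G).lowerCentralSeries n) :
    f x ∈ (⊤ : Subgroup H).lowerCentralSeries n := by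
  have h := Subgroup.mem_map_of_mem f hx
  rw [Subgroup.map_lowerCentralSeries] at h
  have mono : ∀ m, (Subgroup.map f ⊤).lowerCentralSeries m ≤
      (⊤ : Subgroup H).lowerCentralSeries m := by
    intro m
    induction m with
    | zero => exact le_top
    | succ m ih => exact Subgroup.commutator_mono ih le_top
  exact mono n h

/-! ### Free groups are residually nilpotent -/

section Unipotent

variable {G M : Type*} [Group G] [AddCommGroup M] (ρ : G →* (Module.End ℤ M)ˣ)
  (V : ℕ → Submodule ℤ M)

/-- The elements of `G` that, together with their inverses, move each step of the filtration `V`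
by elements `m` steps deeper. -/
def congruenceSubgroup (hV : Antitone V) (m : ℕ) : Subgroup G where
  carrier := {g | ∀ a, ∀ f ∈ V a, (ρ g : Module.End ℤ M) f - f ∈ V (a + m) ∧
    (ρ g⁻¹ : Module.End ℤ M) f - f ∈ V (a + m)}
  one_mem' a f _ := by simp
  inv_mem' {g} hg a f hf := by
    rw [inv_inv]
    exact (hg a f hf).symm
  mul_mem' {g h} hg hh a f hf := by
    have key : ∀ {x y : G} {f : M}, f ∈ V a →
        (∀ f ∈ V a, (ρ x : Module.End ℤ M) f - f ∈ V (a + m)) →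
        (∀ f ∈ V a, (ρ y : Module.End ℤ M) f - f ∈ V (a + m)) →
        (ρ (x * y) : Module.End ℤ M) f - f ∈ V (a + m) := by
      intro x y f hf hx hy
      have h1 := hy f hf
      have h2 : (ρ y : Module.End ℤ M) f ∈ V a := by
        have := (V a).add_mem (hV (Nat.le_add_right a m) h1) hf
        simpa using this
      have := (V (a + m)).add_mem (hx _ h2) h1
      simpa using this
    rw [mul_inv_rev]
    exact ⟨key hf (fun f hf => (hg a f hf).1) fun f hf => (hh a f hf).1,
      key hf (fun f hf => (hh a f hf).2) fun f hf => (hg a f hf).2⟩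

variable {ρ V}

theorem congruenceSubgroup_apply_mem {hV : Antitone V} {m a : ℕ} {g : G}
    (hg : g ∈ congruenceSubgroup ρ V hV m) {f : M} (hf : f ∈ V a) :
    (ρ g : Module.End ℤ M) f ∈ V a := by
  simpa using (V a).add_mem (hV (Nat.le_add_right a m) (hg a f hf).1) hf

theorem commutator_congruenceSubgroup_le (hV : Antitone V) (m n : ℕ) :
    ⁅congruenceSubgroup ρ V hV m, congruenceSubgroup ρ V hV n⁆ ≤
      congruenceSubgroup ρ V hV (m + n) := by
  have key : ∀ {m n : ℕ} {g h : G}, g ∈ congruenceSubgroup ρ V hV m →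
      h ∈ congruenceSubgroup ρ V hV n → ∀ a, ∀ f ∈ V a,
      (ρ ⁅g, h⁆ : Module.End ℤ M) f - f ∈ V (a + (m + n)) := by
    intro m n g h hg hh a f hf
    -- With f = hgf' one has [g, h]f - f = (gh - hg)f' = (g - 1)(h - 1)f' - (h - 1)(g - 1)f', and
    -- the depths add.
    obtain ⟨f', hf', rfl⟩ : ∃ f' ∈ V a, f = (ρ h : Module.End ℤ M) ((ρ g : Module.End ℤ M) f') := by
      refine ⟨(ρ g⁻¹ : Module.End ℤ M) ((ρ h⁻¹ : Module.End ℤ M) f),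
        congruenceSubgroup_apply_mem (inv_mem hg) (congruenceSubgroup_apply_mem (inv_mem hh) hf),
        ?_⟩
      simp only [← Module.End.mul_apply, ← Units.val_mul, ← map_mul]
      simp
    have e : (ρ ⁅g, h⁆ : Module.End ℤ M) ((ρ h : Module.End ℤ M) ((ρ g : Module.End ℤ M) f')) =
        (ρ g : Module.End ℤ M) ((ρ h : Module.End ℤ M) f') := by
      simp only [← Module.End.mul_apply, ← Units.val_mul, ← map_mul]
      simp [commutatorElement_def]
    rw [e]
    have h1 := (hg (a + n) _ (hh a f' hf').1).1
    have h2 := (hh (a + m) _ (hg a f' hf').1).1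
    rw [add_assoc, add_comm n m] at h1
    rw [add_assoc] at h2
    have := (V _).sub_mem h1 h2
    simp only [map_sub] at this
    convert this using 1
    abel
  rw [Subgroup.commutator_le]
  intro g hg h hh a f hf
  refine ⟨key hg hh a f hf, ?_⟩
  rw [commutatorElement_inv, add_comm m n]
  exact key hh hg a f hf

theorem lowerCentralSeries_le_congruenceSubgroup (hV : Antitone V)
    (h : ∀ g, g ∈ congruenceSubgroup ρ V hV 1) (n : ℕ) :
    (⊤ : Subgroup G).lowerCentralSeries n ≤ congruenceSubgroup ρ V hV (n + 1) := by
  induction n with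
  | zero => exact fun g _ => h g
  | succ n ih =>
    exact (Subgroup.commutator_mono ih fun g _ => h g).trans
      (commutator_congruenceSubgroup_le hV _ _)

end Unipotent

/-- The one-parameter group `e ↦ 1 + e N` of units attached to an element `N` of square zero. -/
def squareZeroHom {R : Type*} [Ring R] (N : R) (hN : N * N = 0) : Multiplicative ℤ →* Rˣ where
  toFun e :=
    { val := 1 + e.toAdd • N
      inv := 1 - e.toAdd • N
      val_inv := by simp only [mul_sub, add_mul, smul_mul_smul_comm, hN]; simp
      inv_val := by simp only [mul_add, sub_mul, smul_mul_smul_comm, hN]; simp }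
  map_one' := by ext; simp
  map_mul' a b := by
    ext
    simp only [Units.val_mul, mul_add, add_mul, smul_mul_smul_comm, hN, toAdd_mul, add_smul,
      mul_one, one_mul, smul_zero, add_zero, add_assoc]

/-! ### A unipotent representation attached to a sequence of labels -/

section Shift

variable {ι : Type*} [DecidableEq ι] (κ : ℕ → Option ι)

/-- The operator on integer sequences shifting only at those positions that are labelled `j`. -/
def labelledShift (j : ι) : Module.End ℤ (ℕ → ℤ) where
  toFun f t := if κ t = some j then f (t + 1) else 0
  map_add' f g := by ext t; by_cases h : κ t = some j <;> simp [h]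
  map_smul' c f := by ext t; by_cases h : κ t = some j <;> simp [h]

theorem labelledShift_apply (j : ι) (f : ℕ → ℤ) (t : ℕ) :
    labelledShift κ j f t = if κ t = some j then f (t + 1) else 0 := rfl

variable {κ}

theorem labelledShift_mul_self (hκ : ∀ t j, κ t = some j → κ (t + 1) ≠ some j) (j : ι) :
    labelledShift κ j * labelledShift κ j = 0 := by
  ext f t
  by_cases h : κ t = some j
  · simp [labelledShift_apply, h, hκ t j h]
  · simp [labelledShift_apply, h]

variable (hκ : ∀ t j, κ t = some j → κ (t + 1) ≠ some j)

/-- The exponent of an element of the infinite cyclic group `FreeGroup Unit`. -/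
def exponentHom : FreeGroup Unit ≃* Multiplicative ℤ := FreeGroup.mulEquivIntOfUnique

/-- The representation of a free product of infinite cyclic groups on integer sequences in which
the generator with label `j` acts by `1 + labelledShift κ j`. -/
def shiftRep : Monoid.CoprodI (fun _ : ι => FreeGroup Unit) →* (Module.End ℤ (ℕ → ℤ))ˣ :=
  Monoid.CoprodI.lift fun j =>
    (squareZeroHom _ (labelledShift_mul_self hκ j)).comp exponentHom.toMonoidHom

theorem shiftRep_of (j : ι) (m : FreeGroup Unit) (f : ℕ → ℤ) :
    (shiftRep hκ (Monoid.CoprodI.of (i := j) m) : Module.End ℤ (ℕ → ℤ)) f =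
      f + (exponentHom m).toAdd • labelledShift κ j f := by
  simp [shiftRep, squareZeroHom]

/-- The letters act from the right end of the word. Each one moves the leftmost nonzero entry one
place to the left, because the label there is its own, and multiplies it by its nonzero exponent. -/
theorem shiftRep_prod_apply (l : List (Σ _ : ι, FreeGroup Unit)) (s : ℕ)
    (hl : ∀ t, (l[t]?).map Sigma.fst = κ (s + t)) (hne : ∀ x ∈ l, x.2 ≠ 1) :
    (∀ t < s,
      (shiftRep hκ (l.map fun x => Monoid.CoprodI.of (i := x.1) x.2).prod : Module.End ℤ (ℕ → ℤ))
      (Pi.single (s + l.length) 1) t = 0) ∧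
    (shiftRep hκ (l.map fun x => Monoid.CoprodI.of (i := x.1) x.2).prod : Module.End ℤ (ℕ → ℤ))
      (Pi.single (s + l.length) 1) s ≠ 0 := by
  induction l generalizing s with
  | nil =>
    constructor
    · intro t ht
      simp [ht.ne]
    · simp
  | cons x l ih =>
    obtain ⟨h1, h2⟩ := ih (s + 1) (fun t => by simpa [add_assoc, add_comm 1 t] using hl (t + 1))
      fun y hy => hne y (List.mem_cons_of_mem _ hy)
    have hs : κ s = some x.1 := by simpa using (hl 0).symm
    have e : s + (x :: l).length = s + 1 + l.length := by simp; ring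
    rw [e, List.map_cons, List.prod_cons, map_mul, Units.val_mul, Module.End.mul_apply]
    rw [shiftRep_of]
    constructor
    · intro t ht
      simp only [Pi.add_apply, Pi.smul_apply, labelledShift_apply]
      rw [h1 t (by omega), h1 (t + 1) (by omega)]
      simp
    · simp only [Pi.add_apply, Pi.smul_apply, labelledShift_apply]
      rw [h1 s (by omega), if_pos hs, zero_add, smul_eq_mul]
      refine mul_ne_zero ?_ h2
      intro h
      refine hne x List.mem_cons_self ?_
      have : exponentHom x.2 = 1 := h
      simpa using this

/-- The integer sequences vanishing from position `n + 1 - a` on. -/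
def truncation (n a : ℕ) : Submodule ℤ (ℕ → ℤ) where
  carrier := {f | ∀ t, n < t + a → f t = 0}
  zero_mem' _ _ := rfl
  add_mem' hf hg t ht := by simp [hf t ht, hg t ht]
  smul_mem' c f hf t ht := by simp [hf t ht]

theorem truncation_antitone (n : ℕ) : Antitone (truncation n) :=
  fun _ _ h _ hf t ht => hf t (by omega)

theorem mem_congruenceSubgroup_shiftRep (n : ℕ)
    (g : Monoid.CoprodI (fun _ : ι => FreeGroup Unit)) :
    g ∈ congruenceSubgroup (shiftRep hκ) (truncation n) (truncation_antitone n) 1 := by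
  induction g using Monoid.CoprodI.induction_on with
  | one => exact one_mem _
  | of j m =>
    have key : ∀ m a, ∀ f ∈ truncation n a,
        (shiftRep hκ (Monoid.CoprodI.of (i := j) m) : Module.End ℤ (ℕ → ℤ)) f - f ∈
          truncation n (a + 1) := by
      intro m a f hf t ht
      rw [shiftRep_of]
      by_cases h : κ t = some j
      · simp [labelledShift_apply, h, hf (t + 1) (by omega)]
      · simp [labelledShift_apply, h]
    intro a f hf
    rw [← map_inv]
    exact ⟨key _ a f hf, key _ a f hf⟩
  | mul x y hx hy => exact mul_mem hx hy

end Shift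

/-- A free group is residually nilpotent. -/
theorem iInf_lowerCentralSeries_freeGroup (α : Type*) :
    ⨅ n : ℕ, (⊤ : Subgroup (FreeGroup α)).lowerCentralSeries n = ⊥ := by
  classical
  rw [eq_bot_iff]
  intro g hg
  rw [Subgroup.mem_iInf] at hg
  set e := freeGroupEquivCoprodI (ι := α)
  by_contra hne
  set w := Monoid.CoprodI.Word.equiv (e g) with hw
  have hwp : w.prod = e g := Monoid.CoprodI.Word.equiv.symm_apply_apply (e g)
  set κ : ℕ → Option α := fun t => (w.toList[t]?).map Sigma.fst with hκdef
  have hκ : ∀ t j, κ t = some j → κ (t + 1) ≠ some j := by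
    intro t j h1 h2
    simp only [hκdef, Option.map_eq_some_iff, List.getElem?_eq_some_iff] at h1 h2
    obtain ⟨_, ⟨h1, rfl⟩, rfl⟩ := h1
    obtain ⟨_, ⟨h2, rfl⟩, h3⟩ := h2
    exact (List.isChain_iff_getElem.1 w.chain_ne t h2) h3.symm
  have hmain := shiftRep_prod_apply hκ w.toList 0 (fun t => by simp [hκdef])
    (fun x hx => w.ne_one x hx)
  have hp : (w.toList.map fun x => Monoid.CoprodI.of (i := x.1) x.2).prod = e g := hwp
  rw [hp, zero_add] at hmain
  have hmem := lowerCentralSeries_le_congruenceSubgroup _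
    (mem_congruenceSubgroup_shiftRep hκ w.toList.length) w.toList.length
    (map_mem_lowerCentralSeries e.toMonoidHom (hg w.toList.length))
  -- `lowerCentralSeries n` is γ_{n+1}, so with n the length of the word it moves step `0` of the
  -- filtration into step `n + 1`, which is zero. Thus `e g` fixes the unit vector at n, whose entry
  -- at `0` vanishes as n ≠ 0, against `hmain`.
  have h0 := (hmem 0 (Pi.single w.toList.length 1)
    (fun t ht => Pi.single_eq_of_ne (by omega) _)).1 0 (by omega)
  have hlen : w.toList.length ≠ 0 := by
    intro h
    apply hne
    have : w.toList = [] := List.length_eq_zero_iff.1 h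
    rw [this] at hp
    simpa using hp.symm
  rw [Pi.sub_apply, Pi.single_eq_of_ne (Ne.symm hlen), sub_zero] at h0
  exact hmain.2 h0

end FreeCentral

end

noncomputable section

open scoped commutatorElement

namespace FreeCentral

/-! ### Extensions from 2-cocycles -/

/-- A 2-cocycle on `G` with values in the abelian group `M`, on which `G` acts by `ρ`. -/
structure TwoCocycle {G M : Type*} [Group G] [AddCommGroup M] (ρ : G →* AddMonoid.End M) where
  /-- the underlying function -/
  toFun : G → G → M
  cocycle : ∀ g h k, toFun g h + toFun (g * h) k = ρ g (toFun h k) + toFun g (h * k)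

namespace TwoCocycle

variable {G M : Type*} [Group G] [AddCommGroup M] {ρ : G →* AddMonoid.End M} (f : TwoCocycle ρ)

theorem one_left (h : G) : f.toFun 1 h = f.toFun 1 1 := by
  have := f.cocycle 1 1 h
  simpa using this.symm

theorem one_right (h : G) : f.toFun h 1 = ρ h (f.toFun 1 1) := by
  have := f.cocycle h 1 1
  simpa using this

/-- The extension of `G` by `M` defined by a 2-cocycle. -/
@[ext]
structure Extension (f : TwoCocycle ρ) where
  /-- the component in the kernel -/
  fst : M
  /-- the component in the quotient -/
  snd : G

namespace Extension

variable {f}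

instance : Mul f.Extension :=
  ⟨fun x y => ⟨x.fst + ρ x.snd y.fst + f.toFun x.snd y.snd, x.snd * y.snd⟩⟩

/-- Cocycles are not assumed normalised, whence the correction by the value at (1, 1). -/
instance : One f.Extension := ⟨⟨-f.toFun 1 1, 1⟩⟩

instance : Inv f.Extension :=
  ⟨fun x => ⟨-f.toFun 1 1 - f.toFun x.snd⁻¹ x.snd - ρ x.snd⁻¹ x.fst, x.snd⁻¹⟩⟩

theorem fst_mul (x y : f.Extension) :
    (x * y).fst = x.fst + ρ x.snd y.fst + f.toFun x.snd y.snd := rfl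

theorem snd_mul (x y : f.Extension) : (x * y).snd = x.snd * y.snd := rfl

theorem fst_one : (1 : f.Extension).fst = -f.toFun 1 1 := rfl

theorem snd_one : (1 : f.Extension).snd = 1 := rfl

instance : Group f.Extension :=
  Group.ofLeftAxioms
    (fun x y z => by
      ext
      · have := f.cocycle x.snd y.snd z.snd
        have hρ : (ρ x.snd * ρ y.snd) z.fst = ρ x.snd (ρ y.snd z.fst) := rfl
        simp only [fst_mul, snd_mul, map_add, map_mul, hρ]
        calc _ = x.fst + ρ x.snd y.fst + ρ x.snd (ρ y.snd z.fst) +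
              (f.toFun x.snd y.snd + f.toFun (x.snd * y.snd) z.snd) := by abel
          _ = _ := by rw [this]; abel
      · simp only [snd_mul, mul_assoc])
    (fun x => by
      ext
      · simp [fst_mul, fst_one, snd_one, f.one_left x.snd]
      · simp [snd_mul, snd_one])
    (fun x => by
      ext
      · change -f.toFun 1 1 - f.toFun x.snd⁻¹ x.snd - ρ x.snd⁻¹ x.fst + ρ x.snd⁻¹ x.fst +
          f.toFun x.snd⁻¹ x.snd = -f.toFun 1 1
        abel
      · exact inv_mul_cancel x.snd)

/-- The projection of the extension onto the quotient. -/
def proj : f.Extension →* G where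
  toFun := snd
  map_one' := rfl
  map_mul' _ _ := rfl

theorem proj_surjective : Function.Surjective (proj (f := f)) := fun g => ⟨⟨0, g⟩, rfl⟩

theorem ker_proj_le_center (hρ : ρ = 1) : (proj (f := f)).ker ≤ Subgroup.center f.Extension := by
  subst hρ
  intro x hx
  have hx : x.snd = 1 := hx
  rw [Subgroup.mem_center_iff]
  intro y
  ext
  · rw [fst_mul, fst_mul, hx, f.one_left y.snd, f.one_right y.snd]
    change y.fst + x.fst + f.toFun 1 1 = x.fst + y.fst + f.toFun 1 1
    abel
  · simp [snd_mul, hx]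

end Extension

end TwoCocycle

/-- A homomorphism out of a free group lifts along an epimorphism. -/
theorem exists_freeGroup_lift {α G X : Type*} [Group G] [Group X] (q : X →* G)
    (hq : Function.Surjective q) (φ : FreeGroup α →* G) :
    ∃ θ : FreeGroup α →* X, q.comp θ = φ := by
  choose s hs using hq
  exact ⟨FreeGroup.lift fun a => s (φ (FreeGroup.of a)),
    FreeGroup.ext_hom _ _ fun a => by simp [hs]⟩

/-- A 2-cocycle on a free group is a coboundary. -/
theorem TwoCocycle.exists_eq_coboundary_of_freeGroup {α M : Type*} [AddCommGroup M]
    {ρ : FreeGroup α →* AddMonoid.End M} (f : TwoCocycle ρ) :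
    ∃ a : FreeGroup α → M, ∀ x y, f.toFun x y = a (x * y) - a x - ρ x (a y) := by
  obtain ⟨θ, hθ⟩ := exists_freeGroup_lift (TwoCocycle.Extension.proj (f := f))
    TwoCocycle.Extension.proj_surjective (MonoidHom.id _)
  have h : ∀ x, (θ x).snd = x := fun x => DFunLike.congr_fun hθ x
  refine ⟨fun x => (θ x).fst, fun x y => ?_⟩
  simp only [map_mul, TwoCocycle.Extension.fst_mul, h]
  abel

/-! ### 3-cocycles on free groups -/

/-- A 3-cocycle on `G` with values in the abelian group `A` with trivial action. -/
def IsThreeCocycle {G A : Type*} [Group G] [AddCommGroup A] (c : G → G → G → A) : Prop :=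
  ∀ x y z t, c y z t - c (x * y) z t + c x (y * z) t - c x y (z * t) + c x y z = 0

/-- The 3-coboundary of a 2-cochain. -/
def threeCoboundary {G A : Type*} [Group G] [AddCommGroup A] (b : G → G → A) (x y z : G) : A :=
  b y z - b (x * y) z + b x (y * z) - b x y

/-- The functions `G → A` vanishing at `1`. -/
def pointedFunctions (G A : Type*) [Group G] [AddCommGroup A] : AddSubgroup (G → A) where
  carrier := {m | m 1 = 0}
  zero_mem' := rfl
  add_mem' {m n} hm hn := by
    change m 1 + n 1 = 0
    rw [show m 1 = 0 from hm, show n 1 = 0 from hn, add_zero]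
  neg_mem' {m} hm := by
    change -m 1 = 0
    rw [show m 1 = 0 from hm, neg_zero]

/-- The action of `G` on the pointed functions induced by translation: they represent the quotient
of all functions by the constant ones. -/
def pointedTranslation (G A : Type*) [Group G] [AddCommGroup A] :
    G →* AddMonoid.End (pointedFunctions G A) where
  toFun y :=
    { toFun := fun m => ⟨fun x => m.1 (x * y) - m.1 y, by
        change m.1 (1 * y) - m.1 y = 0
        rw [one_mul, sub_self]⟩
      map_zero' := by ext x; simp
      map_add' := fun m n => by ext x; simp; abel }
  map_one' := by
    ext m x
    have : m.1 1 = 0 := m.2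
    change m.1 (x * 1) - m.1 1 = m.1 x
    rw [mul_one, this, sub_zero]
  map_mul' y z := by
    ext m x
    change m.1 (x * (y * z)) - m.1 (y * z) = m.1 (x * y * z) - m.1 z - (m.1 (y * z) - m.1 z)
    rw [mul_assoc]
    abel

/-- A 3-cocycle with trivial coefficients on a free group is a coboundary. -/
theorem IsThreeCocycle.exists_eq_threeCoboundary_of_freeGroup {α A : Type*} [AddCommGroup A]
    {c : FreeGroup α → FreeGroup α → FreeGroup α → A} (hc : IsThreeCocycle c) :
    ∃ b : FreeGroup α → FreeGroup α → A, c = threeCoboundary b := by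
  -- Dimension shifting: as a function of x modulo constants, c x y z is a 2-cocycle in (y, z).
  -- Subtracting the value at x = 1 picks the representative.
  let f : TwoCocycle (pointedTranslation (FreeGroup α) A) :=
    { toFun := fun y z => ⟨fun x => c x y z - c 1 y z, sub_self _⟩
      cocycle := fun y z t => by
        ext x
        have h1 := hc x y z t
        have h2 := hc 1 y z t
        rw [one_mul] at h2
        change c x y z - c 1 y z + (c x (y * z) t - c 1 (y * z) t) =
          c (x * y) z t - c 1 z t - (c y z t - c 1 z t) + (c x y (z * t) - c 1 y (z * t))
        rw [← sub_eq_zero]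
        rw [← sub_eq_zero.2 (h1.trans h2.symm)]
        abel }
  obtain ⟨g, hg⟩ := f.exists_eq_coboundary_of_freeGroup
  refine ⟨fun x y => c 1 x y + (g y).1 x, ?_⟩
  funext x y z
  have h1 : c x y z - c 1 y z = (g (y * z)).1 x - (g y).1 x - ((g z).1 (x * y) - (g z).1 y) :=
    congrFun (congrArg Subtype.val (hg y z)) x
  have h2 := hc 1 x y z
  rw [one_mul] at h2
  rw [threeCoboundary, eq_add_of_sub_eq h1, ← sub_eq_zero, ← h2]
  abel

end FreeCentral

end

noncomputable section

open scoped commutatorElement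

namespace FreeCentral

/-! ### Homology in terms of cocycles with values in `ℚ/ℤ` -/

/-! ### Separation and extension of characters -/

section Character

variable {R M N : Type*} [CommRing R] [AddCommGroup M] [AddCommGroup N] [Module R M] [Module R N]

theorem exists_character_of_notMem (W : Submodule R M) {x : M} (hx : x ∉ W) :
    ∃ χ : M →+ AddCircle (1 : ℚ), (∀ w ∈ W, χ w = 0) ∧ χ x ≠ 0 := by
  have hx' : W.mkQ x ≠ 0 := by simpa using hx
  obtain ⟨c, hc⟩ := CharacterModule.exists_character_apply_ne_zero_of_ne_zero hx'
  refine ⟨AddMonoidHom.comp c W.mkQ.toAddMonoidHom, fun w hw => ?_, hc⟩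
  have h0 : W.mkQ w = 0 := by simpa using hw
  change c (W.mkQ w) = 0
  rw [h0, map_zero]

/-- Such a `g` is a character of the image of `d`; it extends to `N` because ℚ/ℤ is injective. -/
theorem exists_character_comp_eq (d : M →ₗ[R] N) (g : M →+ AddCircle (1 : ℚ))
    (h : ∀ x, d x = 0 → g x = 0) : ∃ a : N →+ AddCircle (1 : ℚ), ∀ x, g x = a (d x) := by
  let g' : CharacterModule (M ⧸ LinearMap.ker d) :=
    QuotientAddGroup.lift (LinearMap.ker d).toAddSubgroup g fun x hx => h x hx
  obtain ⟨a, ha⟩ := CharacterModule.dual_surjective_of_injective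
    ((LinearMap.ker d).liftQ d le_rfl)
    (LinearMap.ker_eq_bot.1 (Submodule.ker_liftQ_eq_bot _ _ _ le_rfl)) g'
  refine ⟨a, fun x => ?_⟩
  exact (congrArg (fun c : CharacterModule (M ⧸ LinearMap.ker d) =>
    c ((LinearMap.ker d).mkQ x)) ha).symm

end Character

open groupHomology

/-! ### The bar differential with trivial coefficients -/

section Differential

variable (G : Type) [Group G]

/-- The inhomogeneous differential for the trivial module `ℤ`. -/
def trivialDifferential (n : ℕ) : ((Fin (n + 1) → G) →₀ ℤ) →ₗ[ℤ] ((Fin n → G) →₀ ℤ) :=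
  (inhomogeneousChains.d (Rep.trivial ℤ G ℤ) n).hom

variable {G}

theorem trivialDifferential_single (n : ℕ) (g : Fin (n + 1) → G) :
    trivialDifferential G n (Finsupp.single g 1) = Finsupp.single (fun i => g i.succ) 1 +
      ∑ j : Fin (n + 1), (-1 : ℤ) ^ ((j : ℕ) + 1) •
        Finsupp.single (Fin.contractNth j (· * ·) g) (1 : ℤ) :=
  inhomogeneousChains.d_single (A := Rep.trivial ℤ G ℤ) n g (1 : ℤ)

theorem trivialDifferential_two (x y z : G) :
    trivialDifferential G 2 (Finsupp.single ![x, y, z] 1) = Finsupp.single ![y, z] 1 -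
      Finsupp.single ![x * y, z] 1 + Finsupp.single ![x, y * z] 1 - Finsupp.single ![x, y] 1 := by
  have h0 : (fun i : Fin 2 => ![x, y, z] i.succ) = ![y, z] := by ext i; fin_cases i <;> rfl
  have h1 : Fin.contractNth 0 (· * ·) ![x, y, z] = ![x * y, z] := by ext i; fin_cases i <;> rfl
  have h2 : Fin.contractNth 1 (· * ·) ![x, y, z] = ![x, y * z] := by ext i; fin_cases i <;> rfl
  have h3 : Fin.contractNth 2 (· * ·) ![x, y, z] = ![x, y] := by ext i; fin_cases i <;> rfl
  rw [trivialDifferential_single, Fin.sum_univ_three, h0, h1, h2, h3]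
  simp only [Fin.coe_ofNat_eq_mod]
  norm_num
  abel

theorem trivialDifferential_three (x y z t : G) :
    trivialDifferential G 3 (Finsupp.single ![x, y, z, t] 1) = Finsupp.single ![y, z, t] 1 -
      Finsupp.single ![x * y, z, t] 1 + Finsupp.single ![x, y * z, t] 1 -
      Finsupp.single ![x, y, z * t] 1 + Finsupp.single ![x, y, z] 1 := by
  have h0 : (fun i : Fin 3 => ![x, y, z, t] i.succ) = ![y, z, t] := by
    ext i; fin_cases i <;> rfl
  have h1 : Fin.contractNth 0 (· * ·) ![x, y, z, t] = ![x * y, z, t] := by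
    ext i; fin_cases i <;> rfl
  have h2 : Fin.contractNth 1 (· * ·) ![x, y, z, t] = ![x, y * z, t] := by
    ext i; fin_cases i <;> rfl
  have h3 : Fin.contractNth 2 (· * ·) ![x, y, z, t] = ![x, y, z * t] := by
    ext i; fin_cases i <;> rfl
  have h4 : Fin.contractNth 3 (· * ·) ![x, y, z, t] = ![x, y, z] := by
    ext i; fin_cases i <;> rfl
  rw [trivialDifferential_single, Fin.sum_univ_four, h0, h1, h2, h3, h4]
  simp only [Fin.coe_ofNat_eq_mod]
  norm_num
  abel

end Differential

/-- If every 3-cocycle on `G` with values in `ℚ/ℤ` is a coboundary, then `H₃(G) = 0`. -/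
theorem subsingleton_integralHomology_three (G : Type) [Group G]
    (h : ∀ c : G → G → G → AddCircle (1 : ℚ), IsThreeCocycle c → ∃ b, c = threeCoboundary b) :
    Subsingleton (integralHomology G 3) := by
  apply ModuleCat.subsingleton_of_isZero
  change CategoryTheory.Limits.IsZero ((inhomogeneousChains (Rep.trivial ℤ G ℤ)).homology 3)
  rw [← HomologicalComplex.exactAt_iff_isZero_homology,
    HomologicalComplex.exactAt_iff' _ 4 3 2 (by simp) (by simp),
    CategoryTheory.ShortComplex.moduleCat_exact_iff]
  change ∀ x : (Fin 3 → G) →₀ ℤ, (inhomogeneousChains (Rep.trivial ℤ G ℤ)).d 3 2 x = 0 →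
    ∃ y, (inhomogeneousChains (Rep.trivial ℤ G ℤ)).d 4 3 y = x
  rw [inhomogeneousChains.d_def, inhomogeneousChains.d_def]
  change ∀ x : (Fin 3 → G) →₀ ℤ, trivialDifferential G 2 x = 0 →
    ∃ y, trivialDifferential G 3 y = x
  intro x hx
  by_contra hx'
  -- A character vanishing on boundaries restricts to a 3-cocycle on the basis. If that is a
  -- coboundary, χ factors through the differential and so kills the cycle `x`.
  obtain ⟨χ, hχ, hχx⟩ := exists_character_of_notMem (LinearMap.range (trivialDifferential G 3))
    (x := x) (fun ⟨y, hy⟩ => hx' ⟨y, hy⟩)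
  obtain ⟨b, hb⟩ := h (fun x y z => χ (Finsupp.single ![x, y, z] 1)) (by
    intro x y z t
    have := hχ _ ⟨Finsupp.single ![x, y, z, t] (1 : ℤ), rfl⟩
    simpa only [trivialDifferential_three, map_sub, map_add] using this)
  let β : ((Fin 2 → G) →₀ ℤ) →+ AddCircle (1 : ℚ) :=
    Finsupp.liftAddHom fun g => (zmultiplesHom _) (b (g 0) (g 1))
  have hβ : ∀ g, β (Finsupp.single g 1) = b (g 0) (g 1) := fun g => by simp [β]
  have hχβ : χ = β.comp (trivialDifferential G 2).toAddMonoidHom := by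
    refine Finsupp.addHom_ext' fun g => AddMonoidHom.ext_int ?_
    have hg : g = ![g 0, g 1, g 2] := by ext i; fin_cases i <;> rfl
    have hb' := congrFun (congrFun (congrFun hb (g 0)) (g 1)) (g 2)
    change χ (Finsupp.single g 1) = β (trivialDifferential G 2 (Finsupp.single g 1))
    rw [hg, trivialDifferential_two, hb', threeCoboundary]
    simp only [map_sub, map_add, hβ]
    rfl
  apply hχx
  rw [hχβ]
  change β (trivialDifferential G 2 x) = 0
  rw [hx, map_zero]

/-- If the 2-cocycles on `Γ` with values in `ℚ/ℤ` that become coboundaries on `G` are already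
coboundaries, then `H₂(G) → H₂(Γ)` is onto. -/
theorem surjective_integralHomologyMap_two {G Γ : Type} [Group G] [Group Γ] (φ : G →* Γ)
    (h : ∀ f : TwoCocycle (1 : Γ →* AddMonoid.End (AddCircle (1 : ℚ))),
      (∃ a : G → AddCircle (1 : ℚ), ∀ x y, f.toFun (φ x) (φ y) = a x + a y - a (x * y)) →
      ∃ a : Γ → AddCircle (1 : ℚ), ∀ x y, f.toFun x y = a x + a y - a (x * y)) :
    Function.Surjective (integralHomologyMap φ 2) := by
  have d_single : ∀ {H : Type} [Group H] (x y : H),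
      d₂₁ (Rep.trivial ℤ H ℤ) (Finsupp.single (x, y) (1 : ℤ)) =
        (Finsupp.single y 1 - Finsupp.single (x * y) 1 + Finsupp.single x 1 : H →₀ ℤ) :=
    fun x y => d₂₁_single (A := Rep.trivial ℤ _ ℤ) (x, y) 1
  intro ξ
  induction ξ using H2_induction_on with | _ z
  -- Surjectivity says that every 2-cycle of Γ lies in `W`. A character vanishing on `W` is a
  -- 2-cocycle on Γ whose pullback kills the cycles of `G`, hence is a coboundary there.
  let W : Submodule ℤ (Γ × Γ →₀ ℤ) :=
    (cycles₂ (Rep.trivial ℤ G ℤ)).map (chainsMap₂ φ (trivialHom φ)).hom ⊔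
      boundaries₂ (Rep.trivial ℤ Γ ℤ)
  have hz : z.1 ∈ W := by
    by_contra hz
    obtain ⟨χ, hχ, hχz⟩ := exists_character_of_notMem W hz
    let f : TwoCocycle (1 : Γ →* AddMonoid.End (AddCircle (1 : ℚ))) :=
      { toFun := fun x y => χ (Finsupp.single (x, y) 1)
        cocycle := fun x y z => by
          have h0 : χ (d₃₂ (Rep.trivial ℤ Γ ℤ) (Finsupp.single (x, y, z) (1 : ℤ))) = 0 :=
            hχ _ (Submodule.mem_sup_right ⟨Finsupp.single (x, y, z) (1 : ℤ), rfl⟩)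
          have h1 : d₃₂ (Rep.trivial ℤ Γ ℤ) (Finsupp.single (x, y, z) (1 : ℤ)) =
              (Finsupp.single (y, z) 1 - Finsupp.single (x * y, z) 1 +
                Finsupp.single (x, y * z) 1 - Finsupp.single (x, y) 1 : Γ × Γ →₀ ℤ) :=
            d₃₂_single (A := Rep.trivial ℤ Γ ℤ) (x, y, z) 1
          rw [h1] at h0
          simp only [map_sub, map_add] at h0
          change χ (Finsupp.single (x, y) 1) + χ (Finsupp.single (x * y, z) 1) =
            χ (Finsupp.single (y, z) 1) + χ (Finsupp.single (x, y * z) 1)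
          rw [← sub_eq_zero, ← neg_eq_zero, ← h0]
          abel }
    obtain ⟨a, ha⟩ := exists_character_comp_eq (d₂₁ (Rep.trivial ℤ G ℤ)).hom
      (χ.comp (chainsMap₂ φ (trivialHom φ)).hom.toAddMonoidHom)
      (fun x hx => hχ _ (Submodule.mem_sup_left ⟨x, hx, rfl⟩))
    obtain ⟨b, hb⟩ := h f ⟨fun x => a (Finsupp.single x (1 : ℤ)), fun x y => by
      have h0 : χ (chainsMap₂ φ (trivialHom φ) (Finsupp.single (x, y) (1 : ℤ))) =
        a (d₂₁ (Rep.trivial ℤ G ℤ) (Finsupp.single (x, y) (1 : ℤ))) :=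
        ha (Finsupp.single (x, y) (1 : ℤ))
      have h1 : chainsMap₂ φ (trivialHom φ) (Finsupp.single (x, y) (1 : ℤ)) =
          (Finsupp.single (φ x, φ y) 1 : Γ × Γ →₀ ℤ) := by
        simp [trivialHom]
      rw [h1, d_single] at h0
      simp only [map_sub, map_add] at h0
      change χ (Finsupp.single (φ x, φ y) 1) = _
      rw [h0]
      abel⟩
    let β : (Γ →₀ ℤ) →+ AddCircle (1 : ℚ) :=
      Finsupp.liftAddHom fun g => (zmultiplesHom _) (b g)
    have hβ : ∀ g, β (Finsupp.single g 1) = b g := fun g => by simp [β]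
    have hχβ : χ = β.comp (d₂₁ (Rep.trivial ℤ Γ ℤ)).hom.toAddMonoidHom := by
      refine Finsupp.addHom_ext' fun g => AddMonoidHom.ext_int ?_
      change f.toFun g.1 g.2 = β (d₂₁ (Rep.trivial ℤ Γ ℤ) (Finsupp.single (g.1, g.2) (1 : ℤ)))
      rw [d_single, hb]
      simp only [map_sub, map_add, hβ]
      abel
    apply hχz
    rw [hχβ]
    change β (d₂₁ (Rep.trivial ℤ Γ ℤ) z.1) = 0
    have : d₂₁ (Rep.trivial ℤ Γ ℤ) z.1 = 0 := z.2
    rw [this, map_zero]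
  obtain ⟨_, ⟨y, hy, rfl⟩, w, hw, hyw⟩ := Submodule.mem_sup.1 hz
  refine ⟨H2π _ ⟨y, hy⟩, ?_⟩
  rw [H2π_comp_map_apply, H2π_eq_iff, ← hyw]
  change chainsMap₂ φ (trivialHom φ) y - (chainsMap₂ φ (trivialHom φ) y + w) ∈ _
  rw [sub_add_cancel_left]
  exact neg_mem hw

/-- The isomorphism of H₁ with the abelianization tensored with ℤ is natural, as is checked on pure
tensors. -/
theorem bijective_integralHomologyMap_one {G Γ : Type} [Group G] [Group Γ] (φ : G →* Γ)
    (h : Function.Bijective (Abelianization.map φ)) :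
    Function.Bijective (integralHomologyMap φ 1) := by
  let e : Additive (Abelianization G) ≃+ Additive (Abelianization Γ) :=
    MulEquiv.toAdditive (MulEquiv.ofBijective (Abelianization.map φ) h)
  let t := TensorProduct.congr e.toIntLinearEquiv (LinearEquiv.refl ℤ ℤ)
  let eG := H1AddEquivOfIsTrivial (Rep.trivial ℤ G ℤ)
  let eΓ := H1AddEquivOfIsTrivial (Rep.trivial ℤ Γ ℤ)
  have key : ∀ x, integralHomologyMap φ 1 (eG.symm x) = eΓ.symm (t x) := by
    intro x
    induction x using TensorProduct.induction_on with
    | zero => simp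
    | add x y hx hy => simp only [map_add, hx, hy]
    | tmul g a =>
      obtain ⟨g, rfl⟩ := Additive.ofMul.surjective g
      obtain ⟨g, rfl⟩ := QuotientGroup.mk_surjective g
      change integralHomologyMap φ 1
        (H1π _ ((cycles₁IsoOfIsTrivial (Rep.trivial ℤ G ℤ)).inv (Finsupp.single g a))) =
        H1π _ ((cycles₁IsoOfIsTrivial (Rep.trivial ℤ Γ ℤ)).inv (Finsupp.single (φ g) a))
      rw [H1π_comp_map_apply]
      congr 1
      apply Subtype.ext
      change chainsMap₁ φ (trivialHom φ) (Finsupp.single g a) = Finsupp.single (φ g) a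
      simp [trivialHom]
  have : (integralHomologyMap φ 1 : _ → _) = eΓ.symm ∘ t ∘ eG := by
    funext x
    simpa using key (eG x)
  rw [this]
  exact eΓ.symm.bijective.comp (t.bijective.comp eG.bijective)

end FreeCentral

end

noncomputable section

open scoped commutatorElement

namespace FreeCentral

/-! ### Commutators and central elements -/

section Central

variable {G H : Type*} [Group G] [Group H]

theorem commutatorElement_central_mul {z w : G} (hz : z ∈ Subgroup.center G)
    (hw : w ∈ Subgroup.center G) (u v : G) : ⁅z * u, w * v⁆ = ⁅u, v⁆ := by
  rw [Subgroup.mem_center_iff] at hz hw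
  have h1 : z * u * (w * v) = z * w * (u * v) := by
    rw [mul_assoc, ← mul_assoc u w v, hw u]
    simp only [mul_assoc]
  have h2 : w * v * (z * u) = z * w * (v * u) := by
    rw [mul_assoc, ← mul_assoc v z u, hz v, mul_assoc, ← mul_assoc w, hz w, mul_assoc]
  have h3 : ∀ x y : G, ⁅x, y⁆ = x * y * (y * x)⁻¹ := fun x y => by
    rw [commutatorElement_def, mul_inv_rev, ← mul_assoc]
  have h4 : ∀ g, g * (z * w) = z * w * g := fun g => by
    rw [← mul_assoc, hz, mul_assoc, hw, mul_assoc]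
  rw [h3, h3, h1, h2, mul_inv_rev, ← mul_assoc, mul_assoc (z * w), ← h4, mul_inv_cancel_right]

/-- Homomorphisms that differ by central elements agree on the commutator subgroup. -/
theorem eq_of_mem_commutator_of_central {f₁ f₂ : G →* H}
    (h : ∀ x, f₁ x * (f₂ x)⁻¹ ∈ Subgroup.center H) {x : G} (hx : x ∈ commutator G) :
    f₁ x = f₂ x := by
  have : commutator G ≤ f₁.eqLocus f₂ := by
    rw [commutator_def, Subgroup.commutator_le]
    intro a _ b _
    change f₁ ⁅a, b⁆ = f₂ ⁅a, b⁆
    have := commutatorElement_central_mul (h a) (h b) (f₂ a) (f₂ b)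
    simpa [map_commutatorElement] using this
  exact this hx

/-- An element whose commutators with the image of `f` are central commutes with the image of the
commutator subgroup. -/
theorem commute_of_mem_commutator {f : G →* H} {v : H}
    (h : ∀ x, ⁅f x, v⁆ ∈ Subgroup.center H) {x : G} (hx : x ∈ commutator G) :
    Commute (f x) v := by
  have h1 := eq_of_mem_commutator_of_central (f₁ := f) (f₂ := (MulAut.conj v).toMonoidHom.comp f)
    (fun x => by simpa [commutatorElement_def, mul_assoc] using h x) hx
  have h2 : f x = v * f x * v⁻¹ := h1
  exact eq_mul_inv_iff_mul_eq.1 h2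

end Central

/-! ### The lower central series and homomorphisms that are onto modulo commutators -/

section LCS

variable {G H : Type*} [Group G] [Group H]

theorem mk_mem_center_of_mem_lowerCentralSeries {n : ℕ} {a : G}
    (ha : a ∈ (⊤ : Subgroup G).lowerCentralSeries n) :
    (a : G ⧸ (⊤ : Subgroup G).lowerCentralSeries (n + 1)) ∈ Subgroup.center _ := by
  rw [Subgroup.mem_center_iff]
  intro b
  obtain ⟨b, rfl⟩ := QuotientGroup.mk_surjective b
  rw [← QuotientGroup.mk_mul, ← QuotientGroup.mk_mul, eq_comm, QuotientGroup.eq]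
  have : (a * b)⁻¹ * (b * a) = ⁅b⁻¹, a⁻¹⁆ := by
    rw [commutatorElement_def]; group
  rw [this, ← commutatorElement_inv]
  exact inv_mem (Subgroup.commutator_mem_commutator (inv_mem ha) (Subgroup.mem_top _))

/-- In the quotient a' is central. All commutators with a are central as well, so a commutes with
b', a product of commutators. Thus commutation induces a well-defined map on graded pieces, on which
the next two inductions rest. -/
theorem mk_commutatorElement_mul {n : ℕ} {a a' b' : G} (b : G)
    (ha : a ∈ (⊤ : Subgroup G).lowerCentralSeries n)
    (ha' : a' ∈ (⊤ : Subgroup G).lowerCentralSeries (n + 1))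
    (hb' : b' ∈ (⊤ : Subgroup G).lowerCentralSeries 1) :
    ((⁅a * a', b * b'⁆ : G) : G ⧸ (⊤ : Subgroup G).lowerCentralSeries (n + 2)) =
      ((⁅a, b⁆ : G) : G ⧸ (⊤ : Subgroup G).lowerCentralSeries (n + 2)) := by
  set π := QuotientGroup.mk' ((⊤ : Subgroup G).lowerCentralSeries (n + 2))
  have h1 : π a' ∈ Subgroup.center _ := mk_mem_center_of_mem_lowerCentralSeries ha'
  have h2 : Commute (π b') (π a) := by
    refine commute_of_mem_commutator (f := π) (fun x => ?_)
      (by rwa [Subgroup.top_lowerCentralSeries_one] at hb')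
    rw [← map_commutatorElement, ← commutatorElement_inv, map_inv]
    exact inv_mem (mk_mem_center_of_mem_lowerCentralSeries
      (Subgroup.commutator_mem_commutator ha (Subgroup.mem_top _)))
  change π ⁅a * a', b * b'⁆ = π ⁅a, b⁆
  rw [map_commutatorElement, map_commutatorElement, map_mul, map_mul]
  have h3 := commutatorElement_central_mul h1 (one_mem _) (π a) (π b * π b')
  rw [one_mul, ← Subgroup.mem_center_iff.1 h1 (π a)] at h3
  rw [h3, commutatorElement_def, commutatorElement_def, mul_inv_rev]
  have h4 : π a * (π b * π b') * (π a)⁻¹ * ((π b')⁻¹ * (π b)⁻¹) =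
      π a * π b * (π b' * (π a)⁻¹) * (π b')⁻¹ * (π b)⁻¹ := by group
  rw [h4, h2.inv_right.eq]
  group

/-- An endomorphism trivial on the abelianization is trivial on all graded pieces, as these are
generated by iterated commutators. -/
theorem inv_mul_mem_lowerCentralSeries {ψ : G →* G}
    (h : ∀ x, x⁻¹ * ψ x ∈ (⊤ : Subgroup G).lowerCentralSeries 1) {n : ℕ} {x : G}
    (hx : x ∈ (⊤ : Subgroup G).lowerCentralSeries n) :
    x⁻¹ * ψ x ∈ (⊤ : Subgroup G).lowerCentralSeries (n + 1) := by
  have key : (⊤ : Subgroup G).lowerCentralSeries n ≤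
      (QuotientGroup.mk' ((⊤ : Subgroup G).lowerCentralSeries (n + 1))).eqLocus
        ((QuotientGroup.mk' ((⊤ : Subgroup G).lowerCentralSeries (n + 1))).comp ψ) := by
    clear hx x
    induction n with
    | zero => exact fun x _ => QuotientGroup.eq.2 (h x)
    | succ n ih =>
      rw [Subgroup.lowerCentralSeries_succ, Subgroup.commutator_le]
      intro a ha b _
      have e := mk_commutatorElement_mul b ha (QuotientGroup.eq.1 (ih ha)) (h b)
      rw [mul_inv_cancel_left, mul_inv_cancel_left, ← map_commutatorElement ψ] at e
      exact e.symm
  exact QuotientGroup.eq.1 (key hx)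

theorem sup_lowerCentralSeries_eq_top {S : Subgroup G}
    (h : S ⊔ (⊤ : Subgroup G).lowerCentralSeries 1 = ⊤) (n : ℕ) :
    S ⊔ (⊤ : Subgroup G).lowerCentralSeries n = ⊤ := by
  have key : ∀ n, (⊤ : Subgroup G).lowerCentralSeries n ≤
      S ⊔ (⊤ : Subgroup G).lowerCentralSeries (n + 1) := by
    intro n
    induction n with
    | zero => exact h.ge
    | succ n ih =>
      rw [Subgroup.lowerCentralSeries_succ ⊤ n, Subgroup.commutator_le]
      intro a ha b _
      obtain ⟨s, hs, a', ha', rfl⟩ := Subgroup.mem_sup_of_normal_right.1 (ih ha)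
      have hb : b ∈ S ⊔ (⊤ : Subgroup G).lowerCentralSeries 1 := h.ge (Subgroup.mem_top b)
      obtain ⟨t, ht, b', hb', rfl⟩ := Subgroup.mem_sup_of_normal_right.1 hb
      have hs' : s ∈ (⊤ : Subgroup G).lowerCentralSeries n := by
        simpa using mul_mem ha (inv_mem (Subgroup.lowerCentralSeries_antitone _ n.le_succ ha'))
      have e := QuotientGroup.eq.1 (mk_commutatorElement_mul t hs' ha' hb').symm
      have := Subgroup.mul_mem_sup (mul_mem (mul_mem (mul_mem hs ht) (inv_mem hs)) (inv_mem ht)) e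
      rwa [← commutatorElement_def, mul_inv_cancel_left] at this
  induction n with
  | zero => simp
  | succ n ih =>
    exact eq_top_iff.2 (ih.ge.trans (sup_le le_sup_left (key n)))

/-- Two inclusions feed each other. If L ≤ φ(K)·N with N the n-th term, then commutation gains one
step: the error in N becomes central modulo the next term, and φ is onto modulo that term. This
bounds [H, L], and `hL` turns the bound into one for L with n + 1. -/
theorem commutator_le_map_commutator_sup {φ : G →* H} {K : Subgroup G} [K.Normal] {L : Subgroup H}
    (hφ : φ.range ⊔ (⊤ : Subgroup H).lowerCentralSeries 1 = ⊤)
    (hL : L ≤ K.map φ ⊔ ⁅(⊤ : Subgroup H), L⁆) (n : ℕ) :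
    ⁅(⊤ : Subgroup H), L⁆ ≤
      (⁅(⊤ : Subgroup G), K⁆).map φ ⊔ (⊤ : Subgroup H).lowerCentralSeries n := by
  have step : ∀ n, L ≤ K.map φ ⊔ (⊤ : Subgroup H).lowerCentralSeries n →
      ⁅(⊤ : Subgroup H), L⁆ ≤
        (⁅(⊤ : Subgroup G), K⁆).map φ ⊔ (⊤ : Subgroup H).lowerCentralSeries (n + 1) := by
    intro n hn
    rw [Subgroup.commutator_le]
    intro y _ l hl
    obtain ⟨_, ⟨k, hk, rfl⟩, c, hc, rfl⟩ := Subgroup.mem_sup_of_normal_right.1 (hn hl)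
    have hy : y ∈ φ.range ⊔ (⊤ : Subgroup H).lowerCentralSeries (n + 1) :=
      (sup_lowerCentralSeries_eq_top hφ (n + 1)).ge (Subgroup.mem_top y)
    obtain ⟨_, ⟨e, rfl⟩, y', hy', rfl⟩ := Subgroup.mem_sup_of_normal_right.1 hy
    set π := QuotientGroup.mk' ((⊤ : Subgroup H).lowerCentralSeries (n + 1))
    have h1 : π c ∈ Subgroup.center _ := mk_mem_center_of_mem_lowerCentralSeries hc
    have h2 : π y' = 1 := (QuotientGroup.eq_one_iff _).2 hy'
    have h3 : π (φ ⁅e, k⁆) = π ⁅φ e * y', φ k * c⁆ := by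
      simp only [map_commutatorElement, map_mul, h2, mul_one]
      rw [Subgroup.mem_center_iff.1 h1]
      have h4 := (commutatorElement_central_mul (one_mem _) h1 (π (φ e)) (π (φ k))).symm
      rwa [one_mul] at h4
    have := Subgroup.mul_mem_sup (Subgroup.mem_map_of_mem φ
      (Subgroup.commutator_mem_commutator (Subgroup.mem_top e) hk)) (QuotientGroup.eq.1 h3)
    rwa [mul_inv_cancel_left] at this
  have key : ∀ n, L ≤ K.map φ ⊔ (⊤ : Subgroup H).lowerCentralSeries n := by
    intro n
    induction n with
    | zero => simp
    | succ n ih =>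
      refine hL.trans (sup_le le_sup_left ((step n ih).trans (sup_le_sup_right ?_ _)))
      exact Subgroup.map_mono (Subgroup.commutator_le_right _ _)
  exact (step n (key n)).trans
    (sup_le_sup_left (Subgroup.lowerCentralSeries_antitone _ n.le_succ) _)

/-- A homomorphism from `G` to a free group that is an isomorphism modulo commutators
reflects the lower central series. -/
theorem mem_lowerCentralSeries_of_map_mem {α : Type*} {φ : G →* FreeGroup α}
    (hsurj : φ.range ⊔ (⊤ : Subgroup (FreeGroup α)).lowerCentralSeries 1 = ⊤)
    (hinj : ∀ x, φ x ∈ (⊤ : Subgroup (FreeGroup α)).lowerCentralSeries 1 →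
      x ∈ (⊤ : Subgroup G).lowerCentralSeries 1) {n : ℕ} {x : G}
    (hx : φ x ∈ (⊤ : Subgroup (FreeGroup α)).lowerCentralSeries n) :
    x ∈ (⊤ : Subgroup G).lowerCentralSeries n := by
  let π := QuotientGroup.mk' ((⊤ : Subgroup (FreeGroup α)).lowerCentralSeries 1)
  have hπ : Function.Surjective (π.comp φ) := by
    intro y
    obtain ⟨y, rfl⟩ := QuotientGroup.mk_surjective y
    obtain ⟨_, ⟨e, rfl⟩, c, hc, rfl⟩ :=
      Subgroup.mem_sup_of_normal_right.1 (hsurj.ge (Subgroup.mem_top y))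
    exact ⟨e, QuotientGroup.eq.2 (by simpa using hc)⟩
  -- Freeness of the target gives ψ inverting φ on abelianizations. Then x and ψ(φ x) agree one step
  -- deeper than x lies, while ψ(φ x) lies as deep as φ x.
  obtain ⟨ψ, hψ⟩ := exists_freeGroup_lift (π.comp φ) hπ π
  have h1 : ∀ x, x⁻¹ * ψ (φ x) ∈ (⊤ : Subgroup G).lowerCentralSeries 1 := by
    intro x
    apply hinj
    rw [map_mul, map_inv]
    exact QuotientGroup.eq.1 (DFunLike.congr_fun hψ (φ x)).symm
  have key : ∀ m ≤ n, x ∈ (⊤ : Subgroup G).lowerCentralSeries m := by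
    intro m
    induction m with
    | zero => simp
    | succ m ih =>
      intro hm
      have h2 := inv_mul_mem_lowerCentralSeries (ψ := ψ.comp φ) h1 (ih (by omega))
      have h3 : ψ (φ x) ∈ (⊤ : Subgroup G).lowerCentralSeries (m + 1) :=
        Subgroup.lowerCentralSeries_antitone _ hm (map_mem_lowerCentralSeries ψ hx)
      simpa using mul_mem h3 (inv_mem h2)
  exact key n le_rfl

end LCS

/-! ### Epimorphisms of free groups onto free abelian groups -/

/-- The composite of the map induced by `f` with `g` is a surjective endomorphism of a finitely
generated abelian group, hence injective. -/
theorem ker_eq_commutator_of_surjective {α B : Type*} [Finite α] [CommGroup B]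
    (f : FreeGroup α →* B) (hf : Function.Surjective f) (g : B →* Abelianization (FreeGroup α))
    (hg : Function.Surjective g) : f.ker = commutator (FreeGroup α) := by
  refine le_antisymm (fun x hx => ?_) (Abelianization.commutator_subset_ker f)
  let h : Abelianization (FreeGroup α) →* Abelianization (FreeGroup α) :=
    g.comp (Abelianization.lift f)
  have hs : Function.Surjective h := by
    refine hg.comp fun b => ?_
    obtain ⟨y, rfl⟩ := hf b
    exact ⟨Abelianization.of y, Abelianization.lift_apply_of ..⟩
  have : AddGroup.FG (Additive (Abelianization (FreeGroup α))) := by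
    rw [← GroupFG.iff_add_fg]
    exact Group.fg_of_surjective (f := Abelianization.of) QuotientGroup.mk_surjective
  have : Module.Finite ℤ (Additive (Abelianization (FreeGroup α))) :=
    Module.Finite.iff_addGroup_fg.2 inferInstance
  have hi := OrzechProperty.injective_of_surjective_endomorphism
    (MonoidHom.toAdditive h).toIntLinearMap hs
  rw [← Abelianization.ker_of, MonoidHom.mem_ker]
  refine Additive.ofMul.injective (hi ?_)
  change h (Abelianization.of x) = h 1
  rw [map_one]
  change g (Abelianization.lift f (Abelianization.of x)) = 1
  rw [Abelianization.lift_apply_of, show f x = 1 from hx, map_one]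

end FreeCentral

end

noncomputable section

open scoped commutatorElement

namespace FreeCentral

/-! ### Existence of free covers -/

/-- Two copies of `k` letters make `2 * k` letters. -/
def letterEquiv (k : ℕ) : Fin k ⊕ Fin k ≃ Fin (2 * k) :=
  finSumFinEquiv.trans (finCongr (two_mul k).symm)

namespace BalancedPresentation

variable {Q : Type} [Group Q] (P : BalancedPresentation Q)

/-- The inclusion of `F` into the free group on `2 * k` letters given by the first `k` letters. -/
def firstLetters : P.F →* FreeGroup (Fin (2 * P.rank)) :=
  FreeGroup.map fun i => letterEquiv _ (Sum.inl i)

/-- The inclusion of `F` into the free group on `2 * k` letters given by the last `k` letters. -/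
def lastLetters : P.F →* FreeGroup (Fin (2 * P.rank)) :=
  FreeGroup.map fun i => letterEquiv _ (Sum.inr i)

/-- The epimorphism onto `F × F` sending the letters to the generators of the two factors. -/
def prodGenerators : FreeGroup (Fin (2 * P.rank)) →* P.F × P.F :=
  FreeGroup.lift fun a =>
    Sum.elim (fun i => (FreeGroup.of i, 1)) (fun i => (1, FreeGroup.of i)) ((letterEquiv _).symm a)

theorem prodGenerators_surjective : Function.Surjective P.prodGenerators := by
  have h1 : P.prodGenerators.comp P.firstLetters = MonoidHom.inl _ _ :=
    FreeGroup.ext_hom _ _ fun i => by simp [prodGenerators, firstLetters]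
  have h2 : P.prodGenerators.comp P.lastLetters = MonoidHom.inr _ _ :=
    FreeGroup.ext_hom _ _ fun i => by simp [prodGenerators, lastLetters]
  rintro ⟨x, y⟩
  refine ⟨P.firstLetters x * P.lastLetters y, ?_⟩
  rw [map_mul, ← MonoidHom.comp_apply, ← MonoidHom.comp_apply, h1, h2]
  simp

theorem p_rel (i : Fin P.rank) : P.p (P.rel i) = 1 := by
  have : P.rel i ∈ P.p.ker := by
    rw [P.ker_lift]
    exact Subgroup.subset_normalClosure ⟨i, rfl⟩
  exact this

/-- The diagonal homomorphism into the fiber product. -/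
def diagonal : P.F →* P.fiberProduct where
  toFun x := ⟨(x, x), rfl⟩
  map_one' := rfl
  map_mul' _ _ := rfl

/-- The epimorphism onto the fiber product sending the letters to the diagonal elements of the
generators and to the relators in the first factor. -/
def fiberGenerators : FreeGroup (Fin (2 * P.rank)) →* P.fiberProduct :=
  FreeGroup.lift fun a =>
    Sum.elim (fun i => P.diagonal (FreeGroup.of i))
      (fun i => ⟨(P.rel i, 1), by
        change P.p (P.rel i) = P.p 1
        rw [P.p_rel, map_one]⟩) ((letterEquiv _).symm a)

/-- The x with (x, 1) in the image form a normal subgroup, because the image contains the diagonal.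
It contains the relators, hence ker p, and (x, y) = (xy⁻¹, 1)(y, y). -/
theorem fiberGenerators_surjective : Function.Surjective P.fiberGenerators := by
  have h1 : P.fiberGenerators.comp P.firstLetters = P.diagonal :=
    FreeGroup.ext_hom _ _ fun i => by simp [fiberGenerators, firstLetters]
  have hd : ∀ x, (x, x) ∈ P.fiberGenerators.range.map P.fiberProduct.subtype := fun x =>
    ⟨P.diagonal x, ⟨P.firstLetters x, DFunLike.congr_fun h1 x⟩, rfl⟩
  let N : Subgroup P.F :=
    (P.fiberGenerators.range.map P.fiberProduct.subtype).comap (MonoidHom.inl _ _)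
  have hN : N.Normal := ⟨fun n hn g => by
    have hn' : (n, (1 : P.F)) ∈ P.fiberGenerators.range.map P.fiberProduct.subtype := hn
    have := mul_mem (mul_mem (hd g) hn') (inv_mem (hd g))
    change (g * n * g⁻¹, (1 : P.F)) ∈ P.fiberGenerators.range.map P.fiberProduct.subtype
    simpa only [Prod.mk_mul_mk, Prod.inv_mk, mul_one, mul_inv_cancel] using this⟩
  have hR : P.p.ker ≤ N := by
    rw [P.ker_lift]
    refine Subgroup.normalClosure_le_normal ?_
    rintro _ ⟨i, rfl⟩
    refine ⟨_, ⟨FreeGroup.of (letterEquiv _ (Sum.inr i)), rfl⟩, ?_⟩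
    simp [fiberGenerators]
  rintro ⟨⟨x, y⟩, hxy⟩
  have hxy' : P.p x = P.p y := hxy
  have h3 : (x * y⁻¹, 1) ∈ P.fiberGenerators.range.map P.fiberProduct.subtype :=
    hR (by rw [MonoidHom.mem_ker, map_mul, map_inv, hxy', mul_inv_cancel])
  have h4 := mul_mem h3 (hd y)
  simp only [Prod.mk_mul_mk, inv_mul_cancel_right, one_mul] at h4
  obtain ⟨z, ⟨w, rfl⟩, hz⟩ := h4
  exact ⟨w, Subtype.ext hz⟩

theorem nonempty_freeCover : Nonempty (FreeCover P) := by
  obtain ⟨θ, hθ⟩ := exists_freeGroup_lift P.prodGenerators P.prodGenerators_surjective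
    (P.fiberProduct.subtype.comp P.fiberGenerators)
  exact ⟨⟨P.fiberGenerators, P.fiberGenerators_surjective, P.prodGenerators,
    P.prodGenerators_surjective, θ, hθ⟩⟩

/-! ### Abelianizations -/

/-- The abelianization of the two factors. -/
def abProd : P.F × P.F →* Abelianization P.F × Abelianization P.F :=
  Abelianization.of.prodMap Abelianization.of

theorem exists_surjective_abelianization :
    ∃ g : Abelianization P.F × Abelianization P.F →*
      Abelianization (FreeGroup (Fin (2 * P.rank))), Function.Surjective g := by
  refine ⟨(Abelianization.map P.firstLetters).coprod (Abelianization.map P.lastLetters), ?_⟩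
  set g := (Abelianization.map P.firstLetters).coprod (Abelianization.map P.lastLetters)
  have : (⊤ : Subgroup _) ≤ g.range.comap Abelianization.of := by
    rw [← FreeGroup.closure_range_of, Subgroup.closure_le]
    rintro _ ⟨a, rfl⟩
    obtain ⟨a, rfl⟩ := (letterEquiv _).surjective a
    rcases a with i | i
    · exact ⟨(Abelianization.of (FreeGroup.of i), 1), by simp [g, firstLetters]⟩
    · exact ⟨(1, Abelianization.of (FreeGroup.of i)), by simp [g, lastLetters]⟩
  intro x
  obtain ⟨x, rfl⟩ := QuotientGroup.mk_surjective x
  exact this (Subgroup.mem_top x)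

theorem exists_mul_of_isPerfect (hQ : Group.IsPerfect Q) (x : P.F) :
    ∃ r ∈ P.p.ker, ∃ c ∈ commutator P.F, r * c = x := by
  have h : (commutator P.F).map P.p = ⊤ := by
    rw [commutator_def, Subgroup.map_commutator, ← MonoidHom.range_eq_map,
      MonoidHom.range_eq_top.2 P.surjective_lift, ← commutator_def, hQ.commutator_eq_top]
  obtain ⟨c, hc, hcx⟩ := h.ge (Subgroup.mem_top (P.p x))
  refine ⟨x * c⁻¹, ?_, c, hc, by group⟩
  rw [MonoidHom.mem_ker, map_mul, map_inv, hcx, mul_inv_cancel]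

end BalancedPresentation

/-! ### Comparison of 𝓔 and 𝓕 modulo commutators, and generators of L -/

namespace FreeCover

variable {Q : Type} [Group Q] {P : BalancedPresentation Q} (D : FreeCover P)

theorem projF_cover (x : FreeGroup (Fin (2 * P.rank))) : D.projF (D.cover x) = (D.projE x).1 :=
  DFunLike.congr_fun D.projF_comp_cover x

theorem abProd_surjective : Function.Surjective P.abProd := by
  rintro ⟨x, y⟩
  obtain ⟨x, rfl⟩ := QuotientGroup.mk_surjective x
  obtain ⟨y, rfl⟩ := QuotientGroup.mk_surjective y
  exact ⟨(x, y), rfl⟩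

theorem ker_abProd_comp_projF :
    (P.abProd.comp D.projF).ker = commutator (FreeGroup (Fin (2 * P.rank))) := by
  obtain ⟨g, hg⟩ := P.exists_surjective_abelianization
  exact ker_eq_commutator_of_surjective _ (abProd_surjective.comp D.projF_surjective) g hg

theorem L_le_commutator : D.L ≤ commutator (FreeGroup (Fin (2 * P.rank))) := by
  rw [← D.ker_abProd_comp_projF]
  intro x hx
  rw [MonoidHom.mem_ker, MonoidHom.comp_apply, show D.projF x = 1 from hx, map_one]

theorem exists_projE_eq {x y : P.F} (hx : x ∈ P.p.ker) (hy : y ∈ P.p.ker) :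
    ∃ u, (D.projE u).1 = (x, y) := by
  obtain ⟨u, hu⟩ := D.projE_surjective ⟨(x, y), by
    change P.p x = P.p y
    rw [show P.p x = 1 from hx, show P.p y = 1 from hy]⟩
  exact ⟨u, by rw [hu]⟩

/-- Perfectness makes ker p map onto F_ab, and ker p × ker p lies in the fiber product. -/
theorem abProd_comp_projE_surjective (hQ : Group.IsPerfect Q) :
    Function.Surjective ((P.abProd.comp P.fiberProduct.subtype).comp D.projE) := by
  intro z
  obtain ⟨⟨x, y⟩, rfl⟩ := abProd_surjective z
  obtain ⟨r, hr, c, hc, rfl⟩ := P.exists_mul_of_isPerfect hQ x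
  obtain ⟨s, hs, d, hd, rfl⟩ := P.exists_mul_of_isPerfect hQ y
  obtain ⟨u, hu⟩ := D.exists_projE_eq hr hs
  refine ⟨u, ?_⟩
  change P.abProd (D.projE u).1 = _
  rw [hu]
  rw [← Abelianization.ker_of] at hc hd
  refine Prod.ext ?_ ?_
  · change Abelianization.of r = Abelianization.of (r * c)
    rw [map_mul, show Abelianization.of c = 1 from hc, mul_one]
  · change Abelianization.of s = Abelianization.of (s * d)
    rw [map_mul, show Abelianization.of d = 1 from hd, mul_one]

/-- Both commutator subgroups are kernels of the maps to F_ab × F_ab, which are compatible with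
`cover`. For 𝓔 this needs the rank to be exactly 2k. -/
theorem cover_mem_commutator_iff (hQ : Group.IsPerfect Q) (x : FreeGroup (Fin (2 * P.rank))) :
    D.cover x ∈ commutator (FreeGroup (Fin (2 * P.rank))) ↔
      x ∈ commutator (FreeGroup (Fin (2 * P.rank))) := by
  obtain ⟨g, hg⟩ := P.exists_surjective_abelianization
  have h := ker_eq_commutator_of_surjective _ (D.abProd_comp_projE_surjective hQ) g hg
  have h1 : D.cover x ∈ commutator (FreeGroup (Fin (2 * P.rank))) ↔
      D.cover x ∈ (P.abProd.comp D.projF).ker := by rw [D.ker_abProd_comp_projF]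
  rw [h1, ← h]
  simp only [MonoidHom.mem_ker, MonoidHom.comp_apply, D.projF_cover, Subgroup.subtype_apply]

theorem exists_cover_inv_mul_mem (hQ : Group.IsPerfect Q) (y : FreeGroup (Fin (2 * P.rank))) :
    ∃ x, (D.cover x)⁻¹ * y ∈ commutator (FreeGroup (Fin (2 * P.rank))) := by
  obtain ⟨x, hx⟩ := D.abProd_comp_projE_surjective hQ (P.abProd (D.projF y))
  refine ⟨x, ?_⟩
  have hx' : P.abProd (D.projE x).1 = P.abProd (D.projF y) := hx
  rw [← D.ker_abProd_comp_projF, MonoidHom.mem_ker, map_mul, map_inv, MonoidHom.comp_apply,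
    MonoidHom.comp_apply, D.projF_cover, hx', inv_mul_cancel]

theorem range_cover_sup_eq_top (hQ : Group.IsPerfect Q) :
    D.cover.range ⊔
    (⊤ : Subgroup (FreeGroup (Fin (2 * P.rank)))).lowerCentralSeries 1 = ⊤ := by
  rw [eq_top_iff]
  intro y _
  obtain ⟨x, hx⟩ := D.exists_cover_inv_mul_mem hQ y
  rw [← Subgroup.top_lowerCentralSeries_one] at hx
  have := Subgroup.mul_mem_sup (show D.cover x ∈ D.cover.range from ⟨x, rfl⟩) hx
  rwa [mul_inv_cancel_left] at this

/-- The subgroup of `𝓔` generated by the commutators of lifts of elements of the two factors. -/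
def cross : Subgroup (FreeGroup (Fin (2 * P.rank))) :=
  Subgroup.closure {k | ∃ u v, (D.projE u).1.2 = 1 ∧ (D.projE v).1.1 = 1 ∧ k = ⁅u, v⁆}

theorem cross_le_K : D.cross ≤ D.K := by
  rw [cross, Subgroup.closure_le]
  rintro _ ⟨u, v, hu, hv, rfl⟩
  change D.projE ⁅u, v⁆ = 1
  refine Subtype.ext ?_
  rw [map_commutatorElement]
  change ⁅(D.projE u).1, (D.projE v).1⁆ = 1
  refine Prod.ext ?_ ?_
  · change ⁅(D.projE u).1.1, (D.projE v).1.1⁆ = 1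
    rw [hv, commutatorElement_one_right]
  · change ⁅(D.projE u).1.2, (D.projE v).1.2⁆ = 1
    rw [hu, commutatorElement_one_left]

theorem map_K_le_L : D.K.map D.cover ≤ D.L := by
  rintro _ ⟨k, hk, rfl⟩
  rw [MonoidHom.mem_ker, D.projF_cover, show D.projE k = 1 from hk]
  rfl

theorem mk_mem_center {G : Type*} [Group G] {L M : Subgroup G} [M.Normal]
    (h : ⁅(⊤ : Subgroup G), L⁆ ≤ M) {l : G} (hl : l ∈ L) :
    QuotientGroup.mk' M l ∈ Subgroup.center (G ⧸ M) := by
  rw [Subgroup.mem_center_iff]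
  intro y
  obtain ⟨y, rfl⟩ := QuotientGroup.mk_surjective y
  rw [← commutatorElement_eq_one_iff_mul_comm]
  exact (QuotientGroup.eq_one_iff _).2
    (h (Subgroup.commutator_mem_commutator (Subgroup.mem_top y) hl))

/-- Modulo `[𝓕, L]`, the group `L` is generated by commutators of elements of `𝓔`. -/
theorem L_le_map_cross_sup (hQ : Group.IsPerfect Q) :
    D.L ≤ D.cross.map D.cover ⊔ ⁅(⊤ : Subgroup (FreeGroup (Fin (2 * P.rank)))), D.L⁆ := by
  set M := D.cross.map D.cover ⊔ ⁅(⊤ : Subgroup (FreeGroup (Fin (2 * P.rank)))), D.L⁆ with hM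
  have hML : M ≤ D.L := sup_le ((Subgroup.map_mono D.cross_le_K).trans D.map_K_le_L)
    (Subgroup.commutator_le_right _ _)
  have hLM : ⁅(⊤ : Subgroup (FreeGroup (Fin (2 * P.rank)))), D.L⁆ ≤ M := le_sup_right
  have : M.Normal := by
    rw [← Subgroup.commutator_top_left_le_iff]
    exact (Subgroup.commutator_mono le_rfl hML).trans hLM
  set π := QuotientGroup.mk' M
  have hcen : ∀ {l}, D.projF l = 1 → π l ∈ Subgroup.center _ := fun hl => mk_mem_center hLM hl
  obtain ⟨α, hα⟩ := exists_freeGroup_lift D.projF D.projF_surjective (MonoidHom.inl P.F P.F)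
  obtain ⟨β, hβ⟩ := exists_freeGroup_lift D.projF D.projF_surjective (MonoidHom.inr P.F P.F)
  replace hα : ∀ x, D.projF (α x) = (x, 1) := DFunLike.congr_fun hα
  replace hβ : ∀ x, D.projF (β x) = (1, x) := DFunLike.congr_fun hβ
  have hαβ : ∀ x y, ⁅π (α x), π (β y)⁆ ∈ Subgroup.center _ := fun x y => by
    rw [← map_commutatorElement]
    refine hcen ?_
    rw [map_commutatorElement, hα, hβ]
    refine Prod.ext (commutatorElement_one_right x) (commutatorElement_one_left y)
  -- For r and s in ker p, central corrections replace the lifts by images of elements of 𝓔, whose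
  -- commutator is in `cross`.
  have base : ∀ r ∈ P.p.ker, ∀ s ∈ P.p.ker, Commute (π (α r)) (π (β s)) := by
    intro r hr s hs
    obtain ⟨u, hu⟩ := D.exists_projE_eq hr (one_mem _)
    obtain ⟨v, hv⟩ := D.exists_projE_eq (one_mem _) hs
    have h1 : π (α r * (D.cover u)⁻¹) ∈ Subgroup.center _ :=
      hcen (by rw [map_mul, map_inv, hα, D.projF_cover, hu, mul_inv_cancel])
    have h2 : π (β s * (D.cover v)⁻¹) ∈ Subgroup.center _ :=
      hcen (by rw [map_mul, map_inv, hβ, D.projF_cover, hv, mul_inv_cancel])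
    have h3 := commutatorElement_central_mul h1 h2 (π (D.cover u)) (π (D.cover v))
    rw [← map_mul, ← map_mul, inv_mul_cancel_right, inv_mul_cancel_right,
      ← map_commutatorElement π (D.cover u), ← map_commutatorElement D.cover] at h3
    rw [← commutatorElement_eq_one_iff_commute, h3]
    refine (QuotientGroup.eq_one_iff _).2 (Subgroup.mem_sup_left (Subgroup.mem_map_of_mem _ ?_))
    exact Subgroup.subset_closure ⟨u, v, by rw [hu], by rw [hv], rfl⟩
  -- Write x = rc with c a product of commutators. Since the commutators with π(β s) are central,
  -- the factor c contributes nothing.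
  have half : ∀ x, ∀ s ∈ P.p.ker, Commute (π (α x)) (π (β s)) := by
    intro x s hs
    obtain ⟨r, hr, c, hc, rfl⟩ := P.exists_mul_of_isPerfect hQ x
    rw [map_mul, map_mul]
    exact (base r hr s hs).mul_left
      (commute_of_mem_commutator (f := π.comp α) (fun x => hαβ x s) hc)
  have full : ∀ x y, Commute (π (α x)) (π (β y)) := by
    intro x y
    obtain ⟨s, hs, c, hc, rfl⟩ := P.exists_mul_of_isPerfect hQ y
    rw [map_mul, map_mul]
    refine (half x s hs).mul_right
      (commute_of_mem_commutator (f := π.comp β) (v := π (α x)) (fun y => ?_) hc).symm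
    rw [← commutatorElement_inv]
    exact inv_mem (hαβ x y)
  -- Now F × F maps to the quotient by `M`. The maps π and σ ∘ `projF` differ by central elements,
  -- hence agree on the commutator subgroup, which contains L; so π kills L.
  let σ : P.F × P.F →* _ := (π.comp α).noncommCoprod (π.comp β) full
  have hσ : ∀ w, π w * (σ (D.projF w))⁻¹ ∈ Subgroup.center _ := by
    intro w
    have : σ (D.projF w) = π (α (D.projF w).1 * β (D.projF w).2) := by
      rw [map_mul]; rfl
    rw [this, ← map_inv, ← map_mul]
    refine hcen ?_
    rw [map_mul, map_inv, map_mul, hα, hβ]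
    simp
  intro l hl
  have h := eq_of_mem_commutator_of_central (f₁ := π) (f₂ := σ.comp D.projF) hσ
    (D.L_le_commutator hl)
  rw [MonoidHom.comp_apply, show D.projF l = 1 from hl, map_one] at h
  exact (QuotientGroup.eq_one_iff _).1 h

end FreeCover

end FreeCentral

end

noncomputable section

open scoped commutatorElement IsMulCommutative

namespace FreeCentral

/-! ### Residual nilpotency -/

section Pairing

variable {A B G : Type*} [Group A] [Group B] [Group G]

theorem commutatorElement_mul_left_of_central {a b v : G} (h : ⁅b, v⁆ ∈ Subgroup.center G) :
    ⁅a * b, v⁆ = ⁅a, v⁆ * ⁅b, v⁆ := by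
  rw [commutatorElement_mul_left_eq_conj_mul, Subgroup.mem_center_iff.1 h a,
    mul_inv_cancel_right, Subgroup.mem_center_iff.1 h]

theorem commutatorElement_mul_right_of_central {u a b : G} (h : ⁅u, b⁆ ∈ Subgroup.center G) :
    ⁅u, a * b⁆ = ⁅u, a⁆ * ⁅u, b⁆ := by
  rw [← commutatorElement_inv, commutatorElement_mul_left_of_central, mul_inv_rev,
    commutatorElement_inv, commutatorElement_inv, Subgroup.mem_center_iff.1 h]
  rw [← commutatorElement_inv]
  exact inv_mem h

/-- The commutator pairing of two homomorphisms whose images commute modulo the center. -/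
def commutatorPairing (f : A →* G) (g : B →* G) (h : ∀ x y, ⁅f x, g y⁆ ∈ Subgroup.center G) :
    Abelianization A →* Abelianization B →* Subgroup.center G :=
  Abelianization.lift (MonoidHom.mk' (fun x => Abelianization.lift
    (MonoidHom.mk' (fun y => ⟨⁅f x, g y⁆, h x y⟩) fun y y' => Subtype.ext (by
      simpa using commutatorElement_mul_right_of_central (h x y'))))
    fun x x' => Abelianization.hom_ext _ _ (MonoidHom.ext fun y => Subtype.ext (by
      simpa using commutatorElement_mul_left_of_central (h x' y))))

theorem coe_commutatorPairing (f : A →* G) (g : B →* G)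
    (h : ∀ x y, ⁅f x, g y⁆ ∈ Subgroup.center G) (x : A) (y : B) :
    (commutatorPairing f g h (Abelianization.of x) (Abelianization.of y) : G) = ⁅f x, g y⁆ := rfl

end Pairing

/-! ### Heisenberg groups -/

section Heisenberg

variable {A B Z : Type*} [CommGroup A] [CommGroup B] [CommGroup Z] (p : A →* B →* Z)

/-- The 2-cocycle on `A × B` given by a bilinear pairing. -/
def pairingCocycle : TwoCocycle (1 : A × B →* AddMonoid.End (Additive Z)) where
  toFun s t := Additive.ofMul (p s.1 t.2)
  cocycle s t u := by
    change Additive.ofMul (p s.1 t.2 * p (s.1 * t.1) u.2) =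
      Additive.ofMul (p t.1 u.2 * p s.1 (t.2 * u.2))
    rw [map_mul p, map_mul (p s.1), MonoidHom.mul_apply, mul_comm (p t.1 u.2), mul_assoc]

/-- The Heisenberg group of a bilinear pairing. -/
abbrev Heisenberg : Type _ := (pairingCocycle p).Extension

namespace Heisenberg

/-- The inclusion of the values of the pairing into the Heisenberg group. -/
def incl : Z →* Heisenberg p where
  toFun z := ⟨Additive.ofMul z, 1⟩
  map_one' := by
    ext1
    · change (0 : Additive Z) = -Additive.ofMul (p 1 1)
      simp
    · rfl
  map_mul' z w := by
    ext1
    · change Additive.ofMul (z * w) = Additive.ofMul z + Additive.ofMul w + Additive.ofMul (p 1 1)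
      simp
    · exact (one_mul _).symm

theorem incl_injective : Function.Injective (incl p) := fun _ _ h =>
  Additive.ofMul.injective (congrArg TwoCocycle.Extension.fst h)

variable {p}

theorem commutatorElement_eq {x y : Heisenberg p} (hx : x.snd.2 = 1) (hy : y.snd.1 = 1) :
    ⁅x, y⁆ = incl p (p x.snd.1 y.snd.2) := by
  have : x * y = incl p (p x.snd.1 y.snd.2) * (y * x) := by
    ext1
    · change x.fst + y.fst + Additive.ofMul (p x.snd.1 y.snd.2) =
        Additive.ofMul (p x.snd.1 y.snd.2) + (y.fst + x.fst + Additive.ofMul (p y.snd.1 x.snd.2)) +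
          Additive.ofMul (p 1 (y.snd * x.snd).2)
      rw [hx, hy]
      simp only [map_one, ofMul_one, MonoidHom.one_apply]
      abel
    · change x.snd * y.snd = 1 * (y.snd * x.snd)
      rw [one_mul, mul_comm]
  rw [commutatorElement_def, this, mul_assoc, mul_assoc, mul_assoc, ← mul_assoc x]
  group

theorem lowerCentralSeries_two : (⊤ : Subgroup (Heisenberg p)).lowerCentralSeries 2 = ⊥ := by
  rw [Subgroup.lowerCentralSeries_succ, Subgroup.commutator_top_right_eq_bot_iff_le_center,
    Subgroup.top_lowerCentralSeries_one]
  exact (Abelianization.commutator_subset_ker TwoCocycle.Extension.proj).trans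
    (TwoCocycle.Extension.ker_proj_le_center rfl)

end Heisenberg

end Heisenberg

theorem eq_one_of_forall_mem_lowerCentralSeries_prod {α β : Type*} {g : FreeGroup α × FreeGroup β}
    (h : ∀ n, g ∈ (⊤ : Subgroup (FreeGroup α × FreeGroup β)).lowerCentralSeries n) : g = 1 := by
  refine Prod.ext ?_ ?_
  · change g.1 = 1
    rw [← Subgroup.mem_bot, ← iInf_lowerCentralSeries_freeGroup α, Subgroup.mem_iInf]
    exact fun n => map_mem_lowerCentralSeries (MonoidHom.fst _ _) (h n)
  · change g.2 = 1
    rw [← Subgroup.mem_bot, ← iInf_lowerCentralSeries_freeGroup β, Subgroup.mem_iInf]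
    exact fun n => map_mem_lowerCentralSeries (MonoidHom.snd _ _) (h n)

/-! ### The transfinite lower central series of the two central quotients -/

namespace FreeCover

variable {Q : Type} [Group Q] {P : BalancedPresentation Q} (D : FreeCover P)

/-- `L / [𝓕, L]` embeds into a group of nilpotency class two. -/
theorem mem_commutator_of_mem_lowerCentralSeries (hQ : Group.IsPerfect Q)
    {C : Subgroup (FreeGroup (Fin (2 * P.rank)))} [C.Normal]
    (hC : ⁅(⊤ : Subgroup (FreeGroup (Fin (2 * P.rank)))), D.L⁆ = C)
    {l : FreeGroup (Fin (2 * P.rank))} (hl : l ∈ D.L)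
    (hl2 : QuotientGroup.mk' C l ∈
      (⊤ : Subgroup (FreeGroup (Fin (2 * P.rank)) ⧸ C)).lowerCentralSeries 2) : l ∈ C := by
  set π := QuotientGroup.mk' C
  have hcen : ∀ {l}, D.projF l = 1 → π l ∈ Subgroup.center _ := fun hl => mk_mem_center hC.le hl
  obtain ⟨α, hα⟩ := exists_freeGroup_lift D.projF D.projF_surjective (MonoidHom.inl P.F P.F)
  obtain ⟨β, hβ⟩ := exists_freeGroup_lift D.projF D.projF_surjective (MonoidHom.inr P.F P.F)
  replace hα : ∀ x, D.projF (α x) = (x, 1) := DFunLike.congr_fun hα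
  replace hβ : ∀ x, D.projF (β x) = (1, x) := DFunLike.congr_fun hβ
  have hαβ : ∀ x y, ⁅π.comp α x, π.comp β y⁆ ∈ Subgroup.center _ := fun x y => by
    rw [MonoidHom.comp_apply, MonoidHom.comp_apply, ← map_commutatorElement]
    refine hcen ?_
    rw [map_commutatorElement, hα, hβ]
    refine Prod.ext (commutatorElement_one_right x) (commutatorElement_one_left y)
  let B := commutatorPairing (π.comp α) (π.comp β) hαβ
  -- This θ lifts 𝓕 → F_ab × F_ab to the Heisenberg group of the commutator pairing. It sends L to
  -- the center, so it kills [𝓕, L].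
  obtain ⟨θ, hθ⟩ := exists_freeGroup_lift (TwoCocycle.Extension.proj (f := pairingCocycle B))
    TwoCocycle.Extension.proj_surjective (P.abProd.comp D.projF)
  replace hθ : ∀ x, (θ x).snd = P.abProd (D.projF x) := DFunLike.congr_fun hθ
  have hθC : C ≤ θ.ker := by
    refine hC.ge.trans (Subgroup.commutator_le.2 fun y _ l hl => ?_)
    rw [MonoidHom.mem_ker, map_commutatorElement, commutatorElement_eq_one_iff_mul_comm]
    refine Subgroup.mem_center_iff.1 (TwoCocycle.Extension.ker_proj_le_center rfl ?_) (θ y)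
    change (θ l).snd = 1
    rw [hθ, show D.projF l = 1 from hl, map_one]
  -- On the generators of L modulo [𝓕, L], θ recovers the class in 𝓕/[𝓕, L], since both sides are
  -- values of the same pairing.
  have hcross : ∀ k ∈ D.cross, ∃ z : Subgroup.center (FreeGroup (Fin (2 * P.rank)) ⧸ C),
      z.1 = π (D.cover k) ∧ θ (D.cover k) = Heisenberg.incl B z := by
    intro k hk
    induction hk using Subgroup.closure_induction with
    | one => exact ⟨1, by simp, by simp⟩
    | mul x y _ _ hx hy =>
      obtain ⟨z, hz, hz'⟩ := hx
      obtain ⟨w, hw, hw'⟩ := hy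
      exact ⟨z * w, by simp [hz, hw], by simp [hz', hw']⟩
    | inv x _ hx =>
      obtain ⟨z, hz, hz'⟩ := hx
      exact ⟨z⁻¹, by simp [hz], by simp [hz']⟩
    | mem k hk =>
      obtain ⟨u, v, hu, hv, rfl⟩ := hk
      refine ⟨B (Abelianization.of (D.projE u).1.1) (Abelianization.of (D.projE v).1.2), ?_, ?_⟩
      · rw [coe_commutatorPairing]
        have h1 : π (α (D.projE u).1.1 * (D.cover u)⁻¹) ∈ Subgroup.center _ :=
          hcen (by rw [map_mul, map_inv, hα, D.projF_cover, ← hu, mul_inv_cancel])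
        have h2 : π (β (D.projE v).1.2 * (D.cover v)⁻¹) ∈ Subgroup.center _ :=
          hcen (by rw [map_mul, map_inv, hβ, D.projF_cover, ← hv, mul_inv_cancel])
        have h3 := commutatorElement_central_mul h1 h2 (π (D.cover u)) (π (D.cover v))
        rwa [← map_mul, ← map_mul, inv_mul_cancel_right, inv_mul_cancel_right,
          ← map_commutatorElement π (D.cover u), ← map_commutatorElement D.cover] at h3
      · have h1 : (θ (D.cover u)).snd = (Abelianization.of (D.projE u).1.1, 1) := by
          rw [hθ, D.projF_cover]
          exact Prod.ext rfl ((congrArg Abelianization.of hu).trans (map_one _))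
        have h2 : (θ (D.cover v)).snd = (1, Abelianization.of (D.projE v).1.2) := by
          rw [hθ, D.projF_cover]
          exact Prod.ext ((congrArg Abelianization.of hv).trans (map_one _)) rfl
        rw [map_commutatorElement, map_commutatorElement, Heisenberg.commutatorElement_eq
          (by rw [h1]) (by rw [h2]), h1, h2]
  obtain ⟨_, ⟨k, hk, rfl⟩, c, hc, rfl⟩ :=
    Subgroup.mem_sup_of_normal_right.1 (D.L_le_map_cross_sup hQ hl)
  rw [hC] at hc
  obtain ⟨z, hz, hz'⟩ := hcross k hk
  let θ' : FreeGroup (Fin (2 * P.rank)) ⧸ C →* Heisenberg B := QuotientGroup.lift C θ hθC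
  have h2 : θ (D.cover k * c) = 1 := by
    have := map_mem_lowerCentralSeries θ' hl2
    rwa [Heisenberg.lowerCentralSeries_two] at this
  have h3 : θ c = 1 := hθC hc
  rw [map_mul, h3, mul_one, hz'] at h2
  have h4 : z = 1 := Heisenberg.incl_injective B (h2.trans (map_one _).symm)
  refine mul_mem ((QuotientGroup.eq_one_iff _).1 ?_) hc
  exact hz.symm.trans (by rw [h4]; rfl)

/-- Residual nilpotency of F × F places γ_ω inside L/[𝓕, L], which meets γ₃ trivially. -/
theorem residuallyNilpotent (hQ : Group.IsPerfect Q) :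
    ResiduallyNilpotent (CentralQuotient D.L) := by
  rw [ResiduallyNilpotent, transfiniteLCS_omega0, eq_bot_iff]
  intro g hg
  rw [Subgroup.mem_iInf] at hg
  obtain ⟨l, rfl⟩ := QuotientGroup.mk_surjective g
  let ρ : CentralQuotient D.L →* P.F × P.F :=
    QuotientGroup.lift _ D.projF (Subgroup.commutator_le_right _ _)
  have hl : l ∈ D.L := eq_one_of_forall_mem_lowerCentralSeries_prod
    (g := D.projF l) fun n => map_mem_lowerCentralSeries ρ (hg n)
  exact (QuotientGroup.eq_one_iff _).2 (D.mem_commutator_of_mem_lowerCentralSeries hQ rfl hl (hg 2))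

theorem transfiniteLCS_omega0_add_one :
    transfiniteLCS (CentralQuotient D.K) (ω + 1) = ⊥ := by
  rw [transfiniteLCS_add_one _ Ordinal.omega0_ne_zero,
    Subgroup.commutator_top_left_eq_bot_iff_le_center, transfiniteLCS_omega0]
  intro g hg
  rw [Subgroup.mem_iInf] at hg
  obtain ⟨k, rfl⟩ := QuotientGroup.mk_surjective g
  let ρ : CentralQuotient D.K →* P.fiberProduct :=
    QuotientGroup.lift _ D.projE (Subgroup.commutator_le_right _ _)
  have hk : k ∈ D.K := Subtype.ext (eq_one_of_forall_mem_lowerCentralSeries_prod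
    (g := (D.projE k).1) fun n =>
      map_mem_lowerCentralSeries (P.fiberProduct.subtype.comp ρ) (hg n))
  exact mk_mem_center le_rfl hk

/-- For each n some z in [𝓔, K] makes z⁻¹k map into the n-th term for 𝓕. Then z⁻¹k is in the n-th
term for 𝓔, and it has the same class as k. -/
theorem transfiniteLCS_omega0_ne_bot (hQ : Group.IsPerfect Q)
    {k : FreeGroup (Fin (2 * P.rank))}
    (hkL : D.cover k ∈ ⁅(⊤ : Subgroup (FreeGroup (Fin (2 * P.rank)))), D.L⁆)
    (hk : k ∉ ⁅(⊤ : Subgroup (FreeGroup (Fin (2 * P.rank)))), D.K⁆) :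
    transfiniteLCS (CentralQuotient D.K) ω ≠ ⊥ := by
  rw [transfiniteLCS_omega0]
  intro h
  apply hk
  refine (QuotientGroup.eq_one_iff k).1 (Subgroup.mem_bot.1 (h.le ?_))
  rw [Subgroup.mem_iInf]
  intro n
  have h1 := commutator_le_map_commutator_sup (D.range_cover_sup_eq_top hQ)
    ((D.L_le_map_cross_sup hQ).trans
      (sup_le_sup_right (Subgroup.map_mono D.cross_le_K) _)) n hkL
  obtain ⟨_, ⟨z, hz, rfl⟩, c, hc, hzc⟩ := Subgroup.mem_sup_of_normal_right.1 h1
  have h2 : D.cover (z⁻¹ * k) ∈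
      (⊤ : Subgroup (FreeGroup (Fin (2 * P.rank)))).lowerCentralSeries n := by
    rw [map_mul, map_inv, ← hzc, inv_mul_cancel_left]
    exact hc
  have h3 := mem_lowerCentralSeries_of_map_mem (D.range_cover_sup_eq_top hQ)
    (fun x hx => by
      rw [Subgroup.top_lowerCentralSeries_one] at hx ⊢
      exact (D.cover_mem_commutator_iff hQ x).1 hx) h2
  have h4 := map_mem_lowerCentralSeries
    (QuotientGroup.mk' ⁅(⊤ : Subgroup (FreeGroup (Fin (2 * P.rank)))), D.K⁆) h3
  have h5 : QuotientGroup.mk' ⁅(⊤ : Subgroup (FreeGroup (Fin (2 * P.rank)))), D.K⁆ z = 1 :=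
    (QuotientGroup.eq_one_iff _).2 hz
  rw [map_mul, map_inv, h5, inv_one, one_mul] at h4
  exact h4

/-! ### Homological 2-connectedness -/

theorem bijective_abelianization_map_Phi (hQ : Group.IsPerfect Q) :
    Function.Bijective (Abelianization.map D.Phi) := by
  constructor
  · rw [injective_iff_map_eq_one]
    intro x hx
    obtain ⟨x, rfl⟩ := QuotientGroup.mk_surjective x
    obtain ⟨x, rfl⟩ := QuotientGroup.mk_surjective x
    have h1 : D.Phi (x : CentralQuotient D.K) ∈ commutator (CentralQuotient D.L) := by
      rw [← Abelianization.ker_of]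
      exact hx
    have h2 : D.cover x ∈ commutator (FreeGroup (Fin (2 * P.rank))) := by
      rw [commutator_def, ← MonoidHom.range_eq_top.2 (QuotientGroup.mk'_surjective
        ⁅(⊤ : Subgroup (FreeGroup (Fin (2 * P.rank)))), D.L⁆), MonoidHom.range_eq_map,
        ← Subgroup.map_commutator] at h1
      obtain ⟨y, hy, hyx⟩ := h1
      have h3 : y⁻¹ * D.cover x ∈ ⁅(⊤ : Subgroup (FreeGroup (Fin (2 * P.rank)))), D.L⁆ :=
        QuotientGroup.eq.1 hyx
      have := mul_mem hy (Subgroup.commutator_mono le_rfl le_top h3)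
      rwa [mul_inv_cancel_left] at this
    have h3 := (D.cover_mem_commutator_iff hQ x).1 h2
    have h4 := Subgroup.mem_map_of_mem
      (QuotientGroup.mk' ⁅(⊤ : Subgroup (FreeGroup (Fin (2 * P.rank)))), D.K⁆) h3
    rw [commutator_def, Subgroup.map_commutator] at h4
    have h5 := Subgroup.commutator_mono le_top le_top h4
    rw [← commutator_def, ← Abelianization.ker_of] at h5
    exact h5
  · intro y
    obtain ⟨y, rfl⟩ := QuotientGroup.mk_surjective y
    obtain ⟨y, rfl⟩ := QuotientGroup.mk_surjective y
    obtain ⟨x, hx⟩ := D.exists_cover_inv_mul_mem hQ y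
    refine ⟨Abelianization.of (x : CentralQuotient D.K), ?_⟩
    rw [Abelianization.map_of]
    refine QuotientGroup.eq.2 ?_
    have h4 := Subgroup.mem_map_of_mem
      (QuotientGroup.mk' ⁅(⊤ : Subgroup (FreeGroup (Fin (2 * P.rank)))), D.L⁆) hx
    rw [commutator_def, Subgroup.map_commutator] at h4
    exact Subgroup.commutator_mono le_top le_top h4

/-- A central extension of `𝓕 / [𝓕, L]` to which `Φ` lifts is split. -/
theorem exists_splitting_of_lift (hQ : Group.IsPerfect Q) {X : Type*} [Group X]
    {q : X →* CentralQuotient D.L} (hq : Function.Surjective q) (hcen : q.ker ≤ Subgroup.center X)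
    {σ : CentralQuotient D.K →* X} (hσ : q.comp σ = D.Phi) :
    ∃ τ : CentralQuotient D.L →* X, q.comp τ = MonoidHom.id _ := by
  obtain ⟨θ, hθ⟩ := exists_freeGroup_lift q hq
    (QuotientGroup.mk' ⁅(⊤ : Subgroup (FreeGroup (Fin (2 * P.rank)))), D.L⁆)
  have hθ' : ∀ x, q (θ x) = (x : CentralQuotient D.L) := DFunLike.congr_fun hθ
  have hθc : ∀ {x}, x ∈ ⁅(⊤ : Subgroup (FreeGroup (Fin (2 * P.rank)))), D.L⁆ →
      θ x ∈ Subgroup.center X := fun hx =>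
    hcen (by rw [MonoidHom.mem_ker, hθ']; exact (QuotientGroup.eq_one_iff _).2 hx)
  -- On 𝓔, θ ∘ `cover` and the map through σ lift the same homomorphism, so they agree on
  -- commutators; the latter kills [e, k].
  have h1 : ∀ e, ∀ k ∈ D.K, Commute (θ (D.cover e)) (θ (D.cover k)) := by
    intro e k hk
    have hmem : ⁅e, k⁆ ∈ ⁅(⊤ : Subgroup (FreeGroup (Fin (2 * P.rank)))), D.K⁆ :=
      Subgroup.commutator_mem_commutator (Subgroup.mem_top e) hk
    have := eq_of_mem_commutator_of_central (f₁ := θ.comp D.cover)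
      (f₂ := σ.comp (QuotientGroup.mk' ⁅(⊤ : Subgroup (FreeGroup (Fin (2 * P.rank)))), D.K⁆))
      (fun x => hcen (by
        rw [MonoidHom.mem_ker, map_mul, map_inv, MonoidHom.comp_apply, MonoidHom.comp_apply, hθ',
          ← MonoidHom.comp_apply q, hσ]
        exact mul_inv_cancel _))
      (Subgroup.commutator_mono le_rfl le_top hmem : ⁅e, k⁆ ∈ commutator _)
    rw [MonoidHom.comp_apply, MonoidHom.comp_apply,
      show QuotientGroup.mk' ⁅(⊤ : Subgroup (FreeGroup (Fin (2 * P.rank)))), D.K⁆ ⁅e, k⁆ = 1 from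
        (QuotientGroup.eq_one_iff _).2 hmem, map_one, map_commutatorElement,
      map_commutatorElement] at this
    exact commutatorElement_eq_one_iff_commute.1 this
  -- Modulo commutators y comes from 𝓔, and commutators centralise because `cover k` lies in L, so
  -- that [x, `cover k`] has central image under θ.
  have h2 : ∀ y, ∀ k ∈ D.K, Commute (θ y) (θ (D.cover k)) := by
    intro y k hk
    obtain ⟨e, he⟩ := D.exists_cover_inv_mul_mem hQ y
    have := (h1 e k hk).mul_left (commute_of_mem_commutator (f := θ) (fun x => by
      rw [← map_commutatorElement]
      exact hθc (Subgroup.commutator_mem_commutator (Subgroup.mem_top x)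
        (D.map_K_le_L (Subgroup.mem_map_of_mem _ hk)))) he)
    rwa [← map_mul, mul_inv_cancel_left] at this
  have h3 : ⁅(⊤ : Subgroup (FreeGroup (Fin (2 * P.rank)))), D.L⁆ ≤ θ.ker := by
    rw [Subgroup.commutator_le]
    intro y _ l hl
    obtain ⟨_, ⟨k, hk, rfl⟩, c, hc, rfl⟩ :=
      Subgroup.mem_sup_of_normal_right.1 (D.L_le_map_cross_sup hQ hl)
    rw [MonoidHom.mem_ker, map_commutatorElement, commutatorElement_eq_one_iff_commute, map_mul]
    exact (h2 y k (D.cross_le_K hk)).mul_right (Subgroup.mem_center_iff.1 (hθc hc) (θ y))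
  refine ⟨QuotientGroup.lift _ θ h3, MonoidHom.ext fun x => ?_⟩
  obtain ⟨x, rfl⟩ := QuotientGroup.mk_surjective x
  exact hθ' x

/-- A cochain trivialising the pullback of a 2-cocycle is a lift of Φ to its central extension. A
splitting of that extension trivialises the cocycle itself. -/
theorem homologicallyTwoConnected (hQ : Group.IsPerfect Q) : HomologicallyTwoConnected D.Phi := by
  refine ⟨bijective_integralHomologyMap_one _ (D.bijective_abelianization_map_Phi hQ),
    surjective_integralHomologyMap_two _ fun f ⟨a, ha⟩ => ?_⟩
  let σ : CentralQuotient D.K →* f.Extension := MonoidHom.mk' (fun x => ⟨-a x, D.Phi x⟩)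
    fun x y => by
      ext1
      · change -a (x * y) = -a x + -a y + f.toFun (D.Phi x) (D.Phi y)
        rw [ha]
        abel
      · exact map_mul _ _ _
  obtain ⟨τ, hτ⟩ := D.exists_splitting_of_lift hQ (TwoCocycle.Extension.proj_surjective (f := f))
    (TwoCocycle.Extension.ker_proj_le_center rfl) (σ := σ) (MonoidHom.ext fun _ => rfl)
  have h : ∀ x, (τ x).snd = x := DFunLike.congr_fun hτ
  refine ⟨fun x => -(τ x).fst, fun x y => ?_⟩
  simp only [map_mul, TwoCocycle.Extension.fst_mul, h]
  change f.toFun x y = -(τ x).fst + -(τ y).fst - -((τ x).fst + (τ y).fst + f.toFun x y)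
  abel

end FreeCover

end FreeCentral

end

noncomputable section

open scoped commutatorElement

namespace FreeCentral

/-! ### The kernel of `K / [𝓔, K] → L / [𝓕, L]` and `H₃(Q)` -/

namespace BalancedPresentation

variable {Q : Type} [Group Q] (P : BalancedPresentation Q) {A : Type*} [AddCommGroup A]

variable {P} in
-- Compare the coboundary of b at (1, 1, r) and (r, 1, 1) with its value at (1, 1, 1): all three
-- come from (1, 1, 1) in Q.
theorem apply_one_of_mem_ker {c : Q → Q → Q → A} {b : P.F → P.F → A}
    (hb : ∀ x y z, c (P.p x) (P.p y) (P.p z) = threeCoboundary b x y z) {r : P.F}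
    (hr : P.p r = 1) : b 1 r = b 1 1 ∧ b r 1 = b 1 1 := by
  have h0 := hb 1 1 1
  have h1 := hb 1 1 r
  have h2 := hb r 1 1
  rw [hr, ← map_one P.p, h0] at h1 h2
  simp only [threeCoboundary, mul_one, one_mul, sub_self, zero_add] at h1 h2
  exact ⟨(sub_eq_zero.1 h1.symm), by simpa using (sub_eq_zero.1 h2.symm).symm⟩

variable {P} in
/-- The difference of the pullbacks along the two projections, as a 2-cocycle on the fiber
product, of a 2-cochain on `F` whose coboundary comes from `Q`. -/
def differenceCocycle {c : Q → Q → Q → A} {b : P.F → P.F → A}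
    (hb : ∀ x y z, c (P.p x) (P.p y) (P.p z) = threeCoboundary b x y z) :
    TwoCocycle (1 : P.fiberProduct →* AddMonoid.End A) where
  toFun s t := b s.1.1 t.1.1 - b s.1.2 t.1.2
  cocycle s t u := by
    have h1 := hb s.1.1 t.1.1 u.1.1
    have h2 := hb s.1.2 t.1.2 u.1.2
    rw [show P.p s.1.1 = P.p s.1.2 from s.2, show P.p t.1.1 = P.p t.1.2 from t.2,
      show P.p u.1.1 = P.p u.1.2 from u.2, h2] at h1
    simp only [threeCoboundary] at h1
    change b s.1.1 t.1.1 - b s.1.2 t.1.2 +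
        (b (s.1.1 * t.1.1) u.1.1 - b (s.1.2 * t.1.2) u.1.2) =
      b t.1.1 u.1.1 - b t.1.2 u.1.2 +
        (b s.1.1 (t.1.1 * u.1.1) - b s.1.2 (t.1.2 * u.1.2))
    rw [← sub_eq_zero] at h1 ⊢
    rw [← h1]
    abel

/-- If a 3-cocycle on `Q` becomes the coboundary of `b` on `F`, and the difference of the two
pullbacks of `b` to the fiber product is a coboundary, then the 3-cocycle is a coboundary. -/
theorem exists_threeCoboundary_of_difference {c : Q → Q → Q → A} {b : P.F → P.F → A}
    (hb : ∀ x y z, c (P.p x) (P.p y) (P.p z) = threeCoboundary b x y z)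
    (u : P.fiberProduct → A)
    (hu : ∀ s t, u (s * t) = u s + u t + (b s.1.1 t.1.1 - b s.1.2 t.1.2)) :
    ∃ b', c = threeCoboundary b' := by
  classical
  -- U is u corrected to vanish on the diagonal; the value 0 off the fiber product is a dummy.
  let U : P.F → P.F → A := fun x y =>
    if h : P.p x = P.p y then u ⟨(x, y), h⟩ - u (P.diagonal x) else 0
  have hUdef : ∀ {x y} (h : P.p x = P.p y), U x y = u ⟨(x, y), h⟩ - u (P.diagonal x) :=
    fun h => dif_pos h
  have hdiag : ∀ x y, u (P.diagonal (x * y)) = u (P.diagonal x) + u (P.diagonal y) := fun x y => by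
    rw [map_mul, hu]
    simp [diagonal]
  have hU : ∀ {x y x' y'}, P.p x = P.p y → P.p x' = P.p y' →
      U (x * x') (y * y') = U x y + U x' y' + (b x x' - b y y') := by
    intro x y x' y' h h'
    have hm : P.p (x * x') = P.p (y * y') := by rw [map_mul, map_mul, h, h']
    have e : (⟨(x * x', y * y'), hm⟩ : P.fiberProduct) = ⟨(x, y), h⟩ * ⟨(x', y'), h'⟩ := rfl
    rw [hUdef h, hUdef h', hUdef hm, e, hu, hdiag]
    abel
  have hUself : ∀ x, U x x = 0 := fun x => (hUdef rfl).trans (sub_self _)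
  -- Additivity makes U a difference v x - v y. Translating by y reduces it to (a, 1)(1, d) = (a, d)
  -- with a and d in ker p, where the b-terms cancel by `apply_one_of_mem_ker`.
  have hUadd : ∀ {x y z}, P.p x = P.p y → P.p y = P.p z → U x y + U y z = U x z := by
    intro x y z hxy hyz
    obtain ⟨a, rfl⟩ : ∃ a, a * y = x := ⟨x * y⁻¹, inv_mul_cancel_right _ _⟩
    obtain ⟨d, rfl⟩ : ∃ d, d * y = z := ⟨z * y⁻¹, inv_mul_cancel_right _ _⟩
    have ha : P.p a = 1 := by simpa using hxy
    have hd : P.p d = 1 := by simpa using hyz.symm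
    have h1 := hU (ha.trans (map_one P.p).symm) (rfl : P.p y = P.p y)
    have h2 := hU ((map_one P.p).trans hd.symm) (rfl : P.p y = P.p y)
    have h3 := hU (ha.trans hd.symm) (rfl : P.p y = P.p y)
    have h4 := hU (ha.trans (map_one P.p).symm) ((map_one P.p).trans hd.symm)
    rw [(apply_one_of_mem_ker hb ha).2, (apply_one_of_mem_ker hb hd).1, mul_one, one_mul,
      sub_self, add_zero] at h4
    rw [one_mul] at h1 h2
    rw [h1, h2, h3, h4, hUself]
    abel
  choose s hs using P.surjective_lift
  replace hs : ∀ q, P.p (s q) = q := hs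
  let v : P.F → A := fun x => U x (s (P.p x))
  have hv : ∀ {x y}, P.p x = P.p y → U x y = v x - v y := by
    intro x y h
    change U x y = U x (s (P.p x)) - U y (s (P.p y))
    rw [h, ← hUadd h (hs _).symm]
    abel
  -- Substituting U = v x - v y in `hU` shows that this modification of b by a coboundary depends
  -- only on the images in Q.
  let β : P.F → P.F → A := fun x x' => b x x' - v (x * x') + v x + v x'
  have hβ : ∀ x x', β x x' = β (s (P.p x)) (s (P.p x')) := by
    intro x x'
    have h1 := hU (hs (P.p x)).symm (hs (P.p x')).symm
    rw [hv (hs (P.p x)).symm, hv (hs (P.p x')).symm,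
      hv (by rw [map_mul, map_mul, hs, hs])] at h1
    change b x x' - v (x * x') + v x + v x' = _ - _ + _ + _
    rw [← sub_eq_zero] at h1 ⊢
    rw [← neg_eq_zero, ← h1]
    abel
  refine ⟨fun q q' => β (s q) (s q'), ?_⟩
  funext q q' q''
  have h1 := hb (s q) (s q') (s q'')
  rw [hs, hs, hs] at h1
  have h2 := hβ (s q * s q') (s q'')
  have h3 := hβ (s q) (s q' * s q'')
  rw [map_mul, hs, hs, hs] at h2 h3
  rw [h1]
  simp only [threeCoboundary]
  rw [← h2, ← h3]
  simp only [β, mul_assoc]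
  abel

end BalancedPresentation

namespace FreeCover

variable {Q : Type} [Group Q] {P : BalancedPresentation Q} (D : FreeCover P)

/-- If `K / [𝓔, K] → L / [𝓕, L]` is injective, then a central extension of the fiber product in
which lifts of elements of the two factors commute is split. -/
theorem exists_splitting_of_commute (hQ : Group.IsPerfect Q)
    (hinj : ∀ k, D.cover k ∈ ⁅(⊤ : Subgroup (FreeGroup (Fin (2 * P.rank)))), D.L⁆ →
      k ∈ ⁅(⊤ : Subgroup (FreeGroup (Fin (2 * P.rank)))), D.K⁆)
    {X : Type*} [Group X] {q : X →* P.fiberProduct} (hq : Function.Surjective q)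
    (hcen : q.ker ≤ Subgroup.center X)
    (hcomm : ∀ x y, (q x).1.2 = 1 → (q y).1.1 = 1 → Commute x y) :
    ∃ τ : P.fiberProduct →* X, q.comp τ = MonoidHom.id _ := by
  obtain ⟨θ, hθ⟩ := exists_freeGroup_lift q hq D.projE
  have hθ' : ∀ x, q (θ x) = D.projE x := DFunLike.congr_fun hθ
  have h1 : D.cross ≤ θ.ker := by
    rw [cross, Subgroup.closure_le]
    rintro _ ⟨u, v, hu, hv, rfl⟩
    change θ ⁅u, v⁆ = 1
    rw [map_commutatorElement, commutatorElement_eq_one_iff_commute]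
    exact hcomm _ _ (by rw [hθ', hu]) (by rw [hθ', hv])
  have h2 : ⁅(⊤ : Subgroup (FreeGroup (Fin (2 * P.rank)))), D.K⁆ ≤ θ.ker := by
    rw [Subgroup.commutator_le]
    intro y _ k hk
    rw [MonoidHom.mem_ker, map_commutatorElement, commutatorElement_eq_one_iff_mul_comm]
    exact Subgroup.mem_center_iff.1 (hcen (by rw [MonoidHom.mem_ker, hθ']; exact hk)) _
  -- In 𝓕, `cover k` agrees modulo [𝓕, L] with the image of some k₀ in `cross`. Injectivity puts
  -- k₀⁻¹k in [𝓔, K], and θ kills both factors.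
  have h3 : D.projE.ker ≤ θ.ker := by
    intro k hk
    obtain ⟨_, ⟨k₀, hk₀, rfl⟩, c, hc, hkc⟩ := Subgroup.mem_sup_of_normal_right.1
      (D.L_le_map_cross_sup hQ (D.map_K_le_L (Subgroup.mem_map_of_mem _ hk)))
    have h4 : D.cover (k₀⁻¹ * k) ∈ ⁅(⊤ : Subgroup (FreeGroup (Fin (2 * P.rank)))), D.L⁆ := by
      rw [map_mul, map_inv, ← hkc, inv_mul_cancel_left]
      exact hc
    have h5 := mul_mem (h1 hk₀) (h2 (hinj _ h4))
    rwa [mul_inv_cancel_left] at h5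
  refine ⟨D.projE.liftOfSurjective D.projE_surjective ⟨θ, h3⟩, MonoidHom.ext fun x => ?_⟩
  obtain ⟨x, rfl⟩ := D.projE_surjective x
  have h6 : D.projE.liftOfSurjective D.projE_surjective ⟨θ, h3⟩ (D.projE x) = θ x :=
    MonoidHom.liftOfRightInverse_comp_apply ..
  rw [MonoidHom.comp_apply, h6, hθ']
  rfl

theorem exists_mem_of_nontrivial (hQ : Group.IsPerfect Q)
    (hH3 : Nontrivial (integralHomology Q 3)) :
    ∃ k, D.cover k ∈ ⁅(⊤ : Subgroup (FreeGroup (Fin (2 * P.rank)))), D.L⁆ ∧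
      k ∉ ⁅(⊤ : Subgroup (FreeGroup (Fin (2 * P.rank)))), D.K⁆ := by
  by_contra! hinj
  refine not_subsingleton _ (subsingleton_integralHomology_three Q fun c hc => ?_)
  obtain ⟨b, hb⟩ := IsThreeCocycle.exists_eq_threeCoboundary_of_freeGroup
    (c := fun x y z : P.F => c (P.p x) (P.p y) (P.p z)) (fun x y z t => by
      simpa only [map_mul] using hc (P.p x) (P.p y) (P.p z) (P.p t))
  replace hb : ∀ x y z, c (P.p x) (P.p y) (P.p z) = threeCoboundary b x y z := fun x y z =>
    congrFun (congrFun (congrFun hb x) y) z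
  let f := BalancedPresentation.differenceCocycle hb
  obtain ⟨τ, hτ⟩ := D.exists_splitting_of_commute hQ hinj
    (TwoCocycle.Extension.proj_surjective (f := f))
    (TwoCocycle.Extension.ker_proj_le_center rfl) (fun x y hx hy => by
      have hx : x.snd.1.2 = 1 := hx
      have hy : y.snd.1.1 = 1 := hy
      have hr : P.p x.snd.1.1 = 1 := by
        have : P.p x.snd.1.1 = P.p x.snd.1.2 := x.snd.2
        rw [this, hx, map_one]
      have hs : P.p y.snd.1.2 = 1 := by
        have : P.p y.snd.1.1 = P.p y.snd.1.2 := y.snd.2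
        rw [← this, hy, map_one]
      ext1
      · change x.fst + y.fst + (b x.snd.1.1 y.snd.1.1 - b x.snd.1.2 y.snd.1.2) =
          y.fst + x.fst + (b y.snd.1.1 x.snd.1.1 - b y.snd.1.2 x.snd.1.2)
        rw [hx, hy, (BalancedPresentation.apply_one_of_mem_ker hb hr).1,
          (BalancedPresentation.apply_one_of_mem_ker hb hr).2,
          (BalancedPresentation.apply_one_of_mem_ker hb hs).1,
          (BalancedPresentation.apply_one_of_mem_ker hb hs).2, add_comm x.fst]
      · change x.snd * y.snd = y.snd * x.snd
        refine Subtype.ext (Prod.ext ?_ ?_)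
        · change x.snd.1.1 * y.snd.1.1 = y.snd.1.1 * x.snd.1.1
          rw [hy, mul_one, one_mul]
        · change x.snd.1.2 * y.snd.1.2 = y.snd.1.2 * x.snd.1.2
          rw [hx, mul_one, one_mul])
  have h : ∀ s, (τ s).snd = s := DFunLike.congr_fun hτ
  refine P.exists_threeCoboundary_of_difference hb (fun s => (τ s).fst) fun s t => ?_
  rw [map_mul, TwoCocycle.Extension.fst_mul, h, h]
  rfl

end FreeCover

end FreeCentral

end

noncomputable section

open scoped commutatorElement

namespace FreeCentral

/-! ### Finite presentability -/

/-- The kernel of an epimorphism from a free group of finite rank onto a finitely presented group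
is the normal closure of a finite set. -/
theorem isFinitelyNormallyGenerated_ker {G ι : Type*} [Group G] [Finite ι]
    [hG : Group.IsFinitelyPresented G] (ψ : FreeGroup ι →* G) (hψ : Function.Surjective ψ) :
    ψ.ker.IsFinitelyNormallyGenerated := by
  obtain ⟨n, φ, hφ, S, hS, hSφ⟩ := hG.out
  obtain ⟨α, hα⟩ := exists_freeGroup_lift ψ hψ φ
  obtain ⟨β, hβ⟩ := exists_freeGroup_lift φ hφ ψ
  replace hα : ∀ x, ψ (α x) = φ x := DFunLike.congr_fun hα
  replace hβ : ∀ x, φ (β x) = ψ x := DFunLike.congr_fun hβ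
  -- Tietze relators: the given relators rewritten in the new generators, and each new generator
  -- equated with its double rewriting.
  let T : Set (FreeGroup ι) :=
    α '' S ∪ Set.range fun i => (FreeGroup.of i)⁻¹ * α (β (FreeGroup.of i))
  refine ⟨T, (hS.image _).union (Set.finite_range _), le_antisymm ?_ fun y hy => ?_⟩
  · refine Subgroup.normalClosure_le_normal ?_
    rintro _ (⟨s, hs, rfl⟩ | ⟨i, rfl⟩)
    · change ψ (α s) = 1
      rw [hα]
      exact hSφ.le (Subgroup.subset_normalClosure hs)
    · change ψ _ = 1
      rw [map_mul, map_inv, hα, hβ, inv_mul_cancel]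
  · let π := QuotientGroup.mk' (Subgroup.normalClosure T)
    have hT (i : ι) :
        (FreeGroup.of i)⁻¹ * α (β (FreeGroup.of i)) ∈ Subgroup.normalClosure T :=
      Subgroup.subset_normalClosure (Or.inr ⟨i, rfl⟩)
    have h1 : π.comp (α.comp β) = π :=
      FreeGroup.ext_hom _ _ fun i => (QuotientGroup.eq.2 (hT i)).symm
    have h2 : Subgroup.normalClosure S ≤ (π.comp α).ker := Subgroup.normalClosure_le_normal
      fun s hs => (QuotientGroup.eq_one_iff _).2
        (Subgroup.subset_normalClosure (Or.inl ⟨s, hs, rfl⟩))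
    have h3 : β y ∈ φ.ker := by rw [MonoidHom.mem_ker, hβ]; exact hy
    rw [← hSφ] at h3
    have h4 : π y = 1 := (DFunLike.congr_fun h1 y).symm.trans (h2 h3)
    exact (QuotientGroup.eq_one_iff _).1 h4

/-- The commutators [t, s] of generators t of G with normal generators s of N suffice: modulo them
each s commutes with all t, so the image of N is central. -/
theorem isFinitelyNormallyGenerated_commutator_top {G : Type*} [Group G] [hG : Group.FG G]
    {N : Subgroup G} (hN : N.IsFinitelyNormallyGenerated) :
    (⁅(⊤ : Subgroup G), N⁆).IsFinitelyNormallyGenerated := by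
  obtain ⟨S, hS, rfl⟩ := hN
  obtain ⟨T, hT, hTf⟩ := (Subgroup.fg_iff _).1 hG.out
  let U : Set G := Set.image2 (fun t s => ⁅t, s⁆) T S
  refine ⟨U, hTf.image2 _ hS, le_antisymm (Subgroup.normalClosure_le_normal ?_) ?_⟩
  · rintro _ ⟨t, _, s, hs, rfl⟩
    exact Subgroup.commutator_mem_commutator (Subgroup.mem_top t)
      (Subgroup.subset_normalClosure hs)
  · let π := QuotientGroup.mk' (Subgroup.normalClosure U)
    have h1 : Subgroup.normalClosure S ≤ (Subgroup.center _).comap π := by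
      refine Subgroup.normalClosure_le_normal fun s hs => ?_
      have h2 : (⊤ : Subgroup G) ≤ (Subgroup.centralizer {π s}).comap π := by
        rw [← hT, Subgroup.closure_le]
        intro t ht
        change π t ∈ Subgroup.centralizer {π s}
        rw [Subgroup.mem_centralizer_singleton_iff, ← commutatorElement_eq_one_iff_mul_comm,
          ← map_commutatorElement]
        exact (QuotientGroup.eq_one_iff _).2 (Subgroup.subset_normalClosure ⟨t, ht, s, hs, rfl⟩)
      change π s ∈ Subgroup.center _
      rw [Subgroup.mem_center_iff]
      intro g
      obtain ⟨g, rfl⟩ := QuotientGroup.mk_surjective g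
      exact Subgroup.mem_centralizer_singleton_iff.1 (h2 (Subgroup.mem_top g))
    rw [Subgroup.commutator_le]
    intro g _ n hn
    refine (QuotientGroup.eq_one_iff _).1 ?_
    change π ⁅g, n⁆ = 1
    rw [map_commutatorElement, commutatorElement_eq_one_iff_mul_comm]
    exact Subgroup.mem_center_iff.1 (h1 hn) (π g)

/-- A split extension of a free group of finite rank by a free group of finite rank is finitely
presented. -/
theorem isFinitelyPresented_of_split {G α ι : Type*} [Group G] [Finite α] [Finite ι]
    (δ : FreeGroup α →* G) (ν : FreeGroup ι →* G) (q : G →* FreeGroup α)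
    (hδ : q.comp δ = MonoidHom.id _) (hν : Function.Injective ν) (hνq : ν.range = q.ker) :
    Group.IsFinitelyPresented G := by
  let j : FreeGroup ι →* FreeGroup (α ⊕ ι) := FreeGroup.map Sum.inr
  let k : FreeGroup α →* FreeGroup (α ⊕ ι) := FreeGroup.map Sum.inl
  let Ψ : FreeGroup (α ⊕ ι) →* G :=
    FreeGroup.lift (Sum.elim (fun a => δ (FreeGroup.of a)) fun i => ν (FreeGroup.of i))
  have hΨj : ∀ x, Ψ (j x) = ν x := DFunLike.congr_fun
    (show Ψ.comp j = ν from FreeGroup.ext_hom _ _ fun i => by simp [Ψ, j])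
  have hΨk : ∀ x, Ψ (k x) = δ x := DFunLike.congr_fun
    (show Ψ.comp k = δ from FreeGroup.ext_hom _ _ fun i => by simp [Ψ, k])
  replace hδ : ∀ x, q (δ x) = x := DFunLike.congr_fun hδ
  have hqν : ∀ x, q (ν x) = 1 := fun x => hνq.le ⟨x, rfl⟩
  have hconj : ∀ (x : FreeGroup α) (y : FreeGroup ι), ∃ w, ν w = δ x * ν y * (δ x)⁻¹ := by
    intro x y
    have : δ x * ν y * (δ x)⁻¹ ∈ q.ker := by
      rw [MonoidHom.mem_ker, map_mul, map_mul, hqν, mul_one, map_inv, mul_inv_cancel]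
    rw [← hνq] at this
    exact this
  choose w hw using hconj
  let rel : FreeGroup α → FreeGroup ι → FreeGroup (α ⊕ ι) :=
    fun x y => (j (w x y))⁻¹ * (k x * j y * (k x)⁻¹)
  -- Conjugation by the inverses of generators is included so that the image of the kernel letters
  -- is normalised, and not merely mapped into itself.
  let T : Set (FreeGroup (α ⊕ ι)) :=
    (Set.range fun ai : α × ι => rel (FreeGroup.of ai.1) (FreeGroup.of ai.2)) ∪
      Set.range fun ai : α × ι => rel (FreeGroup.of ai.1)⁻¹ (FreeGroup.of ai.2)
  have hrel : ∀ x y, Ψ (rel x y) = 1 := fun x y => by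
    simp only [rel, map_mul, map_inv, hΨj, hΨk, hw, inv_mul_cancel]
  let π := QuotientGroup.mk' (Subgroup.normalClosure T)
  have hS : (π.comp j).range.Normal := by
    have h1 : ∀ x, (∀ i : ι, rel x (FreeGroup.of i) ∈ T) → ∀ s ∈ (π.comp j).range,
        π (k x) * s * (π (k x))⁻¹ ∈ (π.comp j).range := by
      rintro x hx _ ⟨y, rfl⟩
      have h2 : (⊤ : Subgroup (FreeGroup ι)) ≤ (π.comp j).range.comap
          ((MulAut.conj (π (k x))).toMonoidHom.comp (π.comp j)) := by
        rw [← FreeGroup.closure_range_of, Subgroup.closure_le]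
        rintro _ ⟨i, rfl⟩
        exact ⟨w x (FreeGroup.of i), QuotientGroup.eq.2 (Subgroup.subset_normalClosure (hx i))⟩
      exact h2 (Subgroup.mem_top y)
    have h3 : (⊤ : Subgroup (FreeGroup (α ⊕ ι))) ≤
        (Subgroup.normalizer ((π.comp j).range : Set _)).comap π := by
      rw [← FreeGroup.closure_range_of, Subgroup.closure_le]
      rintro _ ⟨a | i, rfl⟩
      · change π (FreeGroup.of (Sum.inl a)) ∈ Subgroup.normalizer _
        have e : FreeGroup.of (Sum.inl a) = k (FreeGroup.of a) := by simp [k]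
        rw [e, Subgroup.mem_normalizer_iff]
        intro s
        refine ⟨h1 (FreeGroup.of a) (fun i => Or.inl ⟨(a, i), rfl⟩) s, fun hs => ?_⟩
        have := h1 (FreeGroup.of a)⁻¹ (fun i => Or.inr ⟨(a, i), rfl⟩) _ hs
        rw [map_inv, map_inv] at this
        convert this using 1
        group
      · refine Subgroup.le_normalizer ?_
        exact ⟨FreeGroup.of i, by simp [j]⟩
    rw [← Subgroup.normalizer_eq_top_iff, eq_top_iff]
    intro x _
    obtain ⟨x, rfl⟩ := QuotientGroup.mk_surjective x
    exact h3 (Subgroup.mem_top x)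
  have htop : (π.comp j).range ⊔ (π.comp k).range = ⊤ := by
    have h3 : (⊤ : Subgroup (FreeGroup (α ⊕ ι))) ≤
        ((π.comp j).range ⊔ (π.comp k).range).comap π := by
      rw [← FreeGroup.closure_range_of, Subgroup.closure_le]
      rintro _ ⟨a | i, rfl⟩
      · exact Subgroup.mem_sup_right ⟨FreeGroup.of a, by simp [k]⟩
      · exact Subgroup.mem_sup_left ⟨FreeGroup.of i, by simp [j]⟩
    rw [eq_top_iff]
    intro x _
    obtain ⟨x, rfl⟩ := QuotientGroup.mk_surjective x
    exact h3 (Subgroup.mem_top x)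
  have hT : T.Finite := (Set.finite_range _).union (Set.finite_range _)
  have hTΨ : Subgroup.normalClosure T ≤ Ψ.ker := by
    refine Subgroup.normalClosure_le_normal ?_
    rintro _ (⟨_, rfl⟩ | ⟨_, rfl⟩) <;> exact hrel _ _
  refine Group.IsFinitelyPresented.of_surjective Ψ (fun g => ?_)
    ⟨T, hT, le_antisymm hTΨ fun e he => ?_⟩
  · have hg : g * (δ (q g))⁻¹ ∈ q.ker := by
      rw [MonoidHom.mem_ker, map_mul, map_inv, hδ, mul_inv_cancel]
    rw [← hνq] at hg
    obtain ⟨y, hy⟩ := hg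
    exact ⟨j y * k (q g), by rw [map_mul, hΨj, hΨk, hy, inv_mul_cancel_right]⟩
  -- Modulo `T` every element has the form j(y)k(x). If Ψ kills it, applying q gives x = 1, and
  -- injectivity of ν gives y = 1.
  · obtain ⟨_, ⟨y, rfl⟩, _, ⟨x, rfl⟩, hyx⟩ :=
      Subgroup.mem_sup_of_normal_left.1 (htop.ge (Subgroup.mem_top (π e)))
    have h1 : (j y * k x)⁻¹ * e ∈ Subgroup.normalClosure T := QuotientGroup.eq.1 hyx
    have h2 : ν y * δ x = 1 := by
      have := hTΨ h1
      rw [MonoidHom.mem_ker, map_mul, map_inv, show Ψ e = 1 from he, mul_one, inv_eq_one,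
        map_mul, hΨj, hΨk] at this
      exact this
    have h3 : x = 1 := by
      have := congrArg q h2
      rwa [map_mul, hqν, hδ, one_mul, map_one] at this
    rw [h3, map_one, mul_one] at h2
    have h4 : y = 1 := hν (h2.trans (map_one ν).symm)
    rw [h3, h4, map_one, map_one, mul_one, inv_one, one_mul] at h1
    exact h1

/-- The abelianization is free abelian on the same basis, and a finitely generated free ℤ-module has
finite bases. -/
theorem finite_generators_of_fg (G : Type) [Group G] [IsFreeGroup G] [Group.FG G] :
    Finite (IsFreeGroup.Generators G) := by
  have h1 : Group.FG (FreeGroup (IsFreeGroup.Generators G)) :=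
    Group.fg_of_surjective (f := (IsFreeGroup.toFreeGroup G).toMonoidHom)
      (IsFreeGroup.toFreeGroup G).surjective
  have h2 : AddGroup.FG (FreeAbelianGroup (IsFreeGroup.Generators G)) := by
    change AddGroup.FG (Additive (Abelianization (FreeGroup (IsFreeGroup.Generators G))))
    rw [← GroupFG.iff_add_fg]
    exact Group.fg_of_surjective (f := Abelianization.of) QuotientGroup.mk_surjective
  have h3 : Module.Finite ℤ (FreeAbelianGroup (IsFreeGroup.Generators G)) :=
    Module.Finite.iff_addGroup_fg.2 h2
  have h4 : Module.Finite ℤ (IsFreeGroup.Generators G →₀ ℤ) :=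
    Module.Finite.equiv (FreeAbelianGroup.equivFinsupp _).toIntLinearEquiv
  exact Module.Finite.finite_basis (Finsupp.basisSingleOne (R := ℤ))

/-- The diagonal splits the second projection, whose kernel is a copy of ker p. As a subgroup of
finite index in F, ker p is free of finite rank. -/
theorem BalancedPresentation.isFinitelyPresented_fiberProduct {Q : Type} [Group Q] [Finite Q]
    (P : BalancedPresentation Q) : Group.IsFinitelyPresented P.fiberProduct := by
  have : P.p.ker.FiniteIndex := inferInstance
  have : Group.FG P.p.ker := inferInstance
  have := finite_generators_of_fg P.p.ker
  let ν₀ : P.p.ker →* P.fiberProduct :=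
    { toFun := fun r => ⟨(r.1, 1), r.2.trans (map_one P.p).symm⟩
      map_one' := rfl
      map_mul' := fun r s => Subtype.ext (Prod.ext rfl (mul_one 1).symm) }
  let e := IsFreeGroup.toFreeGroup P.p.ker
  refine isFinitelyPresented_of_split P.diagonal (ν₀.comp e.symm.toMonoidHom)
    ((MonoidHom.snd _ _).comp P.fiberProduct.subtype) (MonoidHom.ext fun _ => rfl) ?_ ?_
  · refine Function.Injective.comp (g := ν₀) (fun r s h => ?_) e.symm.injective
    exact Subtype.ext (congrArg (fun t : P.fiberProduct => t.1.1) h)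
  · ext t
    constructor
    · rintro ⟨r, rfl⟩
      rfl
    · intro ht
      have ht : t.1.2 = 1 := ht
      have h1 : P.p t.1.1 = P.p t.1.2 := t.2
      refine ⟨e ⟨t.1.1, by rw [MonoidHom.mem_ker, h1, ht, map_one]⟩, ?_⟩
      refine Subtype.ext (Prod.ext ?_ ht.symm)
      simp [ν₀]

theorem FreeCover.isFinitelyPresented {Q : Type} [Group Q] [Finite Q] {P : BalancedPresentation Q}
    (D : FreeCover P) : Group.IsFinitelyPresented (CentralQuotient D.K) := by
  have := P.isFinitelyPresented_fiberProduct
  exact Group.IsFinitelyPresented.quotient _ (isFinitelyNormallyGenerated_commutator_top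
    (isFinitelyNormallyGenerated_ker D.projE D.projE_surjective))

end FreeCentral

end

/-! ### The main theorem -/

open FreeCentral in
theorem mainTheorem3 (Q : Type) [Group Q] (hperf : Group.IsPerfect Q)
    (P : BalancedPresentation Q) (hH3 : Nontrivial (integralHomology Q 3)) :
    Nonempty (FreeCover P) ∧
    ∀ D : FreeCover P,
      Group.FG (CentralQuotient D.K) ∧
      HomologicallyTwoConnected D.Phi ∧
      (transfiniteLCS (CentralQuotient D.K) ω ≠ ⊥ ∧
        transfiniteLCS (CentralQuotient D.K) (ω + 1) = ⊥) ∧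
      ResiduallyNilpotent (CentralQuotient D.L) ∧
      (Finite Q → Group.IsFinitelyPresented (CentralQuotient D.K)) := by
  refine ⟨P.nonempty_freeCover, fun D => ⟨inferInstance, D.homologicallyTwoConnected hperf, ⟨?_,
    D.transfiniteLCS_omega0_add_one⟩, D.residuallyNilpotent hperf, fun _ => D.isFinitelyPresented⟩⟩
  obtain ⟨k, hkL, hk⟩ := D.exists_mem_of_nontrivial hperf hH3
  exact D.transfiniteLCS_omega0_ne_bot hperf hkL hk
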